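/- **Setting.** On $\mathbb C^7$ let $\langle x,y\rangle=\sum_i x_iy_i$, let $\perp$ denote the orthogonal complement with respect to $\langle\cdot,\cdot\rangle$, let bars denote complex conjugation, and for a subspace $W$ let $\pi_W$ be the Hermitian orthogonal projection onto $W$. Identify $\mathbb C^7=\operatorname{Im}(\mathbb O)\otimes\mathbb C$, where the octonions have the imaginary units $e_1,\dots,e_7$ with $e_i^2=-1$, $e_ie_j=-e_je_i$ for $i\neq j$, and $e_ie_j=e_k,\ e_je_k=e_i,\ e_ke_i=e_j$ for $(i,j,k)\in\{(1,5,2),(1,6,3),(1,7,4),(2,7,3),(3,5,4),(4,6,2),(5,6,7)\}$; write $x\cdot y\in\mathbb C^7$ for the imaginary part of the octonion product. Let $\mathbb G_2\subset \mathrm{SO}(7,\mathbb C)$ be the automorphism group of $\mathbb O\otimes\mathbb C$, acting on $\mathbb C^7$. Let $\mathcal L_-^\tau(\mathbb G_2,\mathbb C^7)$ be the set of rational maps $g$ from $\mathbb{CP}^1$ to the complex $7\times7$ matrices that take values in $\mathbb G_2$ on an open dense set, satisfy $\overline{g(\bar\lambda)}=g(\lambda)$, and are holomorphic at $\infty$ with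 $g(\infty)=\mathrm{Id}$. Such a $g$ is *holomorphic at* $z$ if it has no pole at $z$ and $g(z)\in\mathbb G_2$ (and similarly with $\mathrm{SO}(7,\mathbb C)$ instead of $\mathbb G_2$). A line or subspace is *isotropic* if $\langle\cdot,\cdot\rangle$ vanishes on it; a *complex coassociative plane* is an isotropic $2$-plane $\mathcal C\subset\mathbb C^7$ with $\mathcal C\cdot\mathcal C=0$. A pair $(L,K)$ of isotropic lines *satisfies the $\mathbb G_2$ pair condition* if $$K\subset\overline L^{\perp}\quad\text{and}\quad L\oplus\pi_{(L\oplus\overline L)^\perp}K\ \text{ is complex coassociative.}$$ For $\alpha\in\mathbb C\setminus\mathbb R$ and isotropic lines $L,K$ put $$p_{\alpha,L}(\lambda)=\frac{\lambda-\bar\alpha}{\lambda-\alpha}\,\pi_{\overline L}+\pi_{(L\oplus\overline L)^\perp}+\frac{\lambda-\alpha}{\lambda-\bar\alpha}\,\pi_L,\qquad p_{\alpha,L,K}=p_{\alpha,L}\,p_{\alpha,K}.$$ **Proposition.** Let $\alpha\in\mathbb C\setminus\mathbb R$, let $(L,K)$ be a pair of isotropic lines satisfying the $\mathbb G_2$ pair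 condition, and let $h\in\mathcal L_-^\tau(\mathbb G_2,\mathbb C^7)$ be holomorphic at $\alpha$. Set $K'=h(\alpha)^{-1}K$ and $p_{\alpha,K}*h=p_{\alpha,K}\,h\,p_{\alpha,K'}^{-1}$. Then $p_{\alpha,K}*h$ is holomorphic at $\alpha$ as a loop in $\mathrm{SO}(7,\mathbb C)$, so that $L'=(p_{\alpha,K}*h)(\alpha)^{-1}L$ is defined, and: 1. the pair $(L',K')$ satisfies the $\mathbb G_2$ pair condition; 2. $p_{\alpha,L',K'}\in\mathcal L_-^\tau(\mathbb G_2,\mathbb C^7)$, and it has simple poles at $\alpha$ and $\bar\alpha$; 3. $p_{\alpha,L,K}\,h\,p_{\alpha,L',K'}^{-1}\in\mathcal L_-^\tau(\mathbb G_2,\mathbb C^7)$, and it is holomorphic at $\alpha$ and at $\bar\alpha$. -/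

import Mathlib

open scoped Matrix ComplexConjugate

namespace G2Loop

noncomputable section

/-- `ℂ⁷ = Im(𝕆) ⊗ ℂ` with its standard Hermitian inner product. -/
abbrev C7 : Type := EuclideanSpace ℂ (Fin 7)

/-- Complex `7 × 7` matrices, acting on `ℂ⁷`. -/
abbrev Mat7 : Type := Matrix (Fin 7) (Fin 7) ℂ

/-! ### Bilinear form, conjugation, octonions -/

/-- The complex bilinear extension `⟨x, y⟩` of the Euclidean inner product of `ℝ⁷`. -/
def bil (x y : C7) : ℂ := ∑ i, x i * y i

/-- Multiplication table of the imaginary octonion units: with `e₁, …, e₇` indexed by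
`0, …, 6`, the entry `±k` at `(i, j)` means `eᵢ₊₁ eⱼ₊₁ = ±eₖ`; the zeros on the diagonal say that
`eᵢ² = -1` has no imaginary part. -/
def octTable : Matrix (Fin 7) (Fin 7) ℤ :=
  !![ 0, -5, -6, -7,  2,  3,  4;
      5,  0, -7,  6, -1, -4,  3;
      6,  7,  0, -5,  4, -1, -2;
      7, -6,  5,  0, -3,  2, -1;
     -2,  1, -4,  3,  0,  7, -6;
     -3,  4,  1, -2, -7,  0,  5;
     -4, -3,  2,  1,  6, -5,  0]

/-- The coefficient of `e_{k+1}` in `e_{i+1} e_{j+1}`. -/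
def octCoeff (i j k : Fin 7) : ℂ :=
  if octTable i j = (k : ℤ) + 1 then 1
  else if octTable i j = -((k : ℤ) + 1) then -1
  else 0

/-- The product `x · y` on `ℂ⁷`: the imaginary part of the octonion product. -/
def octProd (x y : C7) : C7 :=
  WithLp.toLp 2 fun k => ∑ i, ∑ j, octCoeff i j k * x i * y j

/-- Multiplication of the complexified octonions `𝕆 ⊗ ℂ = ℂ·1 ⊕ ℂ⁷`. -/
def octMul (p q : ℂ × C7) : ℂ × C7 :=
  (p.1 * q.1 - bil p.2 q.2, p.1 • q.2 + q.1 • p.2 + octProd p.2 q.2)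

/-- The linear map of `ℂ⁷` given by a matrix. -/
def act (A : Mat7) : C7 →ₗ[ℂ] C7 := Matrix.toEuclideanLin A

/-- The complex group `𝔾₂`: the automorphism group of `𝕆 ⊗ ℂ`, acting on `ℂ⁷`
(automorphisms fix `1` and preserve the imaginary part). -/
def G2 : Set Mat7 :=
  {A | IsUnit A ∧ ∀ p q : ℂ × C7,
    octMul (p.1, act A p.2) (q.1, act A q.2) =
      ((octMul p q).1, act A (octMul p q).2)}

/-- The complex special orthogonal group `SO(7, ℂ)`. -/
def SO7 : Set Mat7 := {A | Aᵀ * A = 1 ∧ A.det = 1}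

/-! ### Subspaces of `ℂ⁷` -/

/-- Complex conjugation on `ℂ⁷`. -/
def conjVec (x : C7) : C7 := WithLp.toLp 2 fun i => conj (x i)

/-- The complex conjugate of a subspace. -/
def conjSub (W : Submodule ℂ C7) : Submodule ℂ C7 where
  carrier := {x | conjVec x ∈ W}
  add_mem' := by
    intro x y hx hy
    have : conjVec (x + y) = conjVec x + conjVec y := by
      ext i; simp [conjVec]
    simpa only [Set.mem_ofPred_eq, this] using W.add_mem hx hy
  zero_mem' := by
    have : conjVec 0 = 0 := by ext i; simp [conjVec]
    simp only [Set.mem_ofPred_eq, this, W.zero_mem]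
  smul_mem' := by
    intro c x hx
    have : conjVec (c • x) = conj c • conjVec x := by
      ext i; simp [conjVec]
    simpa only [Set.mem_ofPred_eq, this] using W.smul_mem (conj c) hx

/-- The orthogonal complement with respect to the bilinear form. -/
def bilPerp (W : Submodule ℂ C7) : Submodule ℂ C7 where
  carrier := {x | ∀ y ∈ W, bil x y = 0}
  add_mem' := by
    intro x x' hx hx' y hy
    have : bil (x + x') y = bil x y + bil x' y := by
      simp [bil, add_mul, Finset.sum_add_distrib]
    rw [this, hx y hy, hx' y hy, add_zero]
  zero_mem' := by intro y _; simp [bil]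
  smul_mem' := by
    intro c x hx y hy
    have : bil (c • x) y = c * bil x y := by
      simp [bil, Finset.mul_sum, mul_assoc]
    rw [this, hx y hy, mul_zero]

/-- A subspace on which the bilinear form vanishes. -/
def IsIsotropic (W : Submodule ℂ C7) : Prop := ∀ x ∈ W, ∀ y ∈ W, bil x y = 0

/-- An isotropic line. -/
def IsIsotropicLine (L : Submodule ℂ C7) : Prop :=
  Module.finrank ℂ L = 1 ∧ IsIsotropic L

/-- A complex coassociative plane: an isotropic `2`-plane `C` with `C · C = 0`. -/
def IsComplexCoassociative (C : Submodule ℂ C7) : Prop :=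
  Module.finrank ℂ C = 2 ∧ IsIsotropic C ∧ ∀ x ∈ C, ∀ y ∈ C, octProd x y = 0

/-- `(L ⊕ L̄)^⊥`. -/
def midSpace (L : Submodule ℂ C7) : Submodule ℂ C7 := bilPerp (L ⊔ conjSub L)

/-- The `𝔾₂` pair condition: isotropic lines `L`, `K` with `K ⊆ L̄^⊥` such that
`L ⊕ π_{(L ⊕ L̄)^⊥} K` is complex coassociative. -/
structure IsG2Pair (L K : Submodule ℂ C7) : Prop where
  left_line : IsIsotropicLine L
  right_line : IsIsotropicLine K
  perp : K ≤ bilPerp (conjSub L)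
  coassoc : IsComplexCoassociative
    (L ⊔ K.map ((midSpace L).starProjection : C7 →ₗ[ℂ] C7))

/-! ### Rational loops -/

/-- Rational maps from the Riemann sphere to complex `7 × 7` matrices. -/
abbrev RatMat : Type := Matrix (Fin 7) (Fin 7) (RatFunc ℂ)

/-- No entry of `g` has a pole at `z`. -/
def RegularAt (g : RatMat) (z : ℂ) : Prop := ∀ i j, (g i j).denom.eval z ≠ 0

/-- The value `g(z)`, meaningful where `g` has no pole. -/
def value (g : RatMat) (z : ℂ) : Mat7 :=
  fun i j => (g i j).eval (RingHom.id ℂ) z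

/-- `g` is holomorphic at `z` as a loop in `G`: it has no pole there and `g(z) ∈ G`. -/
def HolomorphicAt (G : Set Mat7) (g : RatMat) (z : ℂ) : Prop :=
  RegularAt g z ∧ value g z ∈ G

/-- `g` has a simple pole at `z`. -/
def HasSimplePoleAt (g : RatMat) (z : ℂ) : Prop :=
  ¬ RegularAt g z ∧ RegularAt ((RatFunc.X - RatFunc.C z : RatFunc ℂ) • g) z

/-- The rational loops in `G` that satisfy the reality condition for `τ(A) = Ā` and are
negative, i.e. holomorphic at `∞` with value `1`. -/
structure IsNegRealLoop (G : Set Mat7) (g : RatMat) : Prop where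
  loop : ∃ U : Set ℂ, IsOpen U ∧ Dense U ∧ ∀ z ∈ U, HolomorphicAt G g z
  real : ∀ z : ℂ, RegularAt g z → RegularAt g (conj z) →
    (value g (conj z)).map (starRingEnd ℂ) = value g z
  neg : Filter.Tendsto (value g) (Bornology.cobounded ℂ) (nhds 1)

/-- The matrix of the Hermitian orthogonal projection onto `W`. -/
def projMat (W : Submodule ℂ C7) : Mat7 :=
  Matrix.toEuclideanLin.symm (W.starProjection : C7 →ₗ[ℂ] C7)

/-- A constant matrix as a rational map. -/
def constMat (A : Mat7) : RatMat := A.map RatFunc.C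

/-- The rational function `(λ - α) / (λ - ᾱ)`. -/
def moeb (α : ℂ) : RatFunc ℂ :=
  (RatFunc.X - RatFunc.C α) / (RatFunc.X - RatFunc.C (conj α))

/-- The simple element `p_{α,L}` of an isotropic line `L`:
`(λ - ᾱ)/(λ - α) π_{L̄} + π_{(L ⊕ L̄)^⊥} + (λ - α)/(λ - ᾱ) π_L`. -/
def simpleElt (α : ℂ) (L : Submodule ℂ C7) : RatMat :=
  (moeb α)⁻¹ • constMat (projMat (conjSub L)) + constMat (projMat (midSpace L))
    + moeb α • constMat (projMat L)

/-- `p_{α,L,K} = p_{α,L} p_{α,K}`. -/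
def pairElt (α : ℂ) (L K : Submodule ℂ C7) : RatMat := simpleElt α L * simpleElt α K

/-- The line `h(α)⁻¹ L`. -/
def pullLine (α : ℂ) (h : RatMat) (L : Submodule ℂ C7) : Submodule ℂ C7 :=
  L.map (act (value h α)⁻¹)

/-- `p_{α,K} * h = p_{α,K} h p_{α,K'}⁻¹` with `K' = h(α)⁻¹ K`. -/
def dress (α : ℂ) (K : Submodule ℂ C7) (h : RatMat) : RatMat :=
  simpleElt α K * h * (simpleElt α (pullLine α h K))⁻¹

end

end G2Loop

open G2Loop

/-!
Fix vectors `l` and `k` spanning `L` and `K`. The loop `p_{α,K} * h` is regular at `α` because `h`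
is orthogonal and `h(α)` carries `K'` to `K`, so that the double pole and both simple poles of
`p_{α,K} h p_{α,K'}⁻¹` cancel. Dressing a second time, by `L`, gives a loop `f` which is
orthogonal and regular at `α` and satisfies `f p_{α,L',K'} = p_{α,L,K} h`.

The product `p_{α,L,K}` has at most a simple pole at `α` exactly when `K ⊆ L̄^⊥`, and the pair
condition can then be read off its residue `R`, whose transpose maps a vector `y` to a combination
of `k` and `π_{(K ⊕ K̄)^⊥} l`. As `f(α)` and `h(α)` are invertible, the displayed identity shows
that `p_{α,L',K'}` has at most a simple pole as well, with residue `f(α)ᵀ R h(α)`. Since `h(α)`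
preserves the octonion product, the pair condition for `(L, K)` passes to `(L', K')`.

Finally, `p_{α,L,K}` takes values in `𝔾₂` because it is the product of a torus element, diagonal
with respect to a frame adapted to the coassociative plane and its conjugate, and exponentials of
derivations of the octonions. Hence `f` takes values in `𝔾₂` too.
-/

namespace G2Loop

open Matrix Filter

/-! ### The octonion cross product -/

section Cross

variable {R : Type*} [CommRing R]

/-- The imaginary part of the product of two imaginary octonions, over any commutative ring: the
form of `octProd` that can be used both for vectors of constants and of rational functions. -/
def octCross : (Fin 7 → R) →ₗ[R] (Fin 7 → R) →ₗ[R] (Fin 7 → R) :=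
  LinearMap.mk₂ R (fun x y =>
    ![-(x 1 * y 4 - x 4 * y 1) - (x 2 * y 5 - x 5 * y 2) - (x 3 * y 6 - x 6 * y 3),
      (x 0 * y 4 - x 4 * y 0) - (x 2 * y 6 - x 6 * y 2) + (x 3 * y 5 - x 5 * y 3),
      (x 0 * y 5 - x 5 * y 0) + (x 1 * y 6 - x 6 * y 1) - (x 3 * y 4 - x 4 * y 3),
      (x 0 * y 6 - x 6 * y 0) - (x 1 * y 5 - x 5 * y 1) + (x 2 * y 4 - x 4 * y 2),
      -(x 0 * y 1 - x 1 * y 0) - (x 2 * y 3 - x 3 * y 2) + (x 5 * y 6 - x 6 * y 5),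
      -(x 0 * y 2 - x 2 * y 0) + (x 1 * y 3 - x 3 * y 1) - (x 4 * y 6 - x 6 * y 4),
      -(x 0 * y 3 - x 3 * y 0) - (x 1 * y 2 - x 2 * y 1) + (x 4 * y 5 - x 5 * y 4)])
    (fun _ _ _ => by ext i; fin_cases i <;> simp <;> ring)
    (fun _ _ _ => by ext i; fin_cases i <;> simp <;> ring)
    (fun _ _ _ => by ext i; fin_cases i <;> simp <;> ring)
    (fun _ _ _ => by ext i; fin_cases i <;> simp <;> ring)

theorem octCross_apply (x y : Fin 7 → R) : octCross x y =
    ![-(x 1 * y 4 - x 4 * y 1) - (x 2 * y 5 - x 5 * y 2) - (x 3 * y 6 - x 6 * y 3),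
      (x 0 * y 4 - x 4 * y 0) - (x 2 * y 6 - x 6 * y 2) + (x 3 * y 5 - x 5 * y 3),
      (x 0 * y 5 - x 5 * y 0) + (x 1 * y 6 - x 6 * y 1) - (x 3 * y 4 - x 4 * y 3),
      (x 0 * y 6 - x 6 * y 0) - (x 1 * y 5 - x 5 * y 1) + (x 2 * y 4 - x 4 * y 2),
      -(x 0 * y 1 - x 1 * y 0) - (x 2 * y 3 - x 3 * y 2) + (x 5 * y 6 - x 6 * y 5),
      -(x 0 * y 2 - x 2 * y 0) + (x 1 * y 3 - x 3 * y 1) - (x 4 * y 6 - x 6 * y 4),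
      -(x 0 * y 3 - x 3 * y 0) - (x 1 * y 2 - x 2 * y 1) + (x 4 * y 5 - x 5 * y 4)] :=
  rfl

theorem octCross_self (x : Fin 7 → R) : octCross x x = 0 := by
  ext i; fin_cases i <;> simp [octCross_apply] <;> ring

theorem octCross_anticomm (x y : Fin 7 → R) : -octCross x y = octCross y x := by
  ext i; fin_cases i <;> simp [octCross_apply] <;> ring

theorem octCross_dotProduct_rotate (x y z : Fin 7 → R) :
    octCross x y ⬝ᵥ z = octCross y z ⬝ᵥ x := by
  simp [octCross_apply, dotProduct, Fin.sum_univ_succ]; ring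

theorem octCross_octCross_add (x z y : Fin 7 → R) :
    octCross x (octCross z y) + octCross z (octCross x y) =
      (x ⬝ᵥ y) • z + (z ⬝ᵥ y) • x - (2 * (x ⬝ᵥ z)) • y := by
  ext i
  fin_cases i <;> simp [octCross_apply, dotProduct, Fin.sum_univ_succ] <;> ring

theorem map_comp_octCross {S : Type*} [CommRing S] (φ : R →+* S) (x y : Fin 7 → R) :
    φ ∘ octCross x y = octCross (φ ∘ x) (φ ∘ y) := by
  ext i; fin_cases i <;> simp [octCross_apply]

/-- Two null vectors that are orthogonal and have vanishing octonion product; when they are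
independent they span a complex coassociative plane. -/
structure IsNullPair (l w : Fin 7 → R) : Prop where
  left_null : l ⬝ᵥ l = 0
  orth : l ⬝ᵥ w = 0
  right_null : w ⬝ᵥ w = 0
  octCross_eq_zero : octCross l w = 0

namespace IsNullPair

variable {l w l' w' : Fin 7 → R}

theorem symm (h : IsNullPair l w) : IsNullPair w l :=
  ⟨h.right_null, by rw [dotProduct_comm, h.orth], h.left_null, by
    rw [← octCross_anticomm, h.octCross_eq_zero, neg_zero]⟩

theorem octCross_octCross (h : IsNullPair l w) (y : Fin 7 → R) :
    octCross l (octCross w y) = (2 * (l ⬝ᵥ y)) • w - (w ⬝ᵥ y) • l := by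
  have := octCross_octCross_add l y w
  rw [h.octCross_eq_zero, h.orth, map_zero, ← octCross_anticomm w y, map_neg,
    dotProduct_comm y w] at this
  linear_combination (norm := module) -this

theorem skew_octCross (h2 : IsUnit (2 : R)) (h : IsNullPair l w) (x y : Fin 7 → R) :
    (w ⬝ᵥ octCross x y) • l - (l ⬝ᵥ octCross x y) • w =
      octCross ((w ⬝ᵥ x) • l - (l ⬝ᵥ x) • w) y +
        octCross x ((w ⬝ᵥ y) • l - (l ⬝ᵥ y) • w) := by
  have triple : octCross l (octCross x y) = -octCross x (octCross l y) +
      (x ⬝ᵥ y) • l + (l ⬝ᵥ y) • x - (2 * (x ⬝ᵥ l)) • y := by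
    linear_combination (norm := module) octCross_octCross_add x l y
  have w_orth : w ⬝ᵥ octCross l y = 0 := by
    rw [dotProduct_comm, ← octCross_dotProduct_rotate, h.symm.octCross_eq_zero, zero_dotProduct]
  have x_dot : x ⬝ᵥ octCross l y = -(l ⬝ᵥ octCross x y) := by
    rw [dotProduct_comm, octCross_dotProduct_rotate, ← octCross_anticomm, neg_dotProduct,
      dotProduct_comm]
  have wl := h.symm.octCross_octCross (octCross x y)
  have wx := octCross_octCross_add w x (octCross l y)
  rw [h.symm.octCross_octCross] at wx
  rw [triple] at wl
  simp only [map_add, map_sub, map_smul, map_neg, LinearMap.sub_apply, LinearMap.smul_apply,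
    h.symm.octCross_eq_zero, w_orth, x_dot, ← octCross_anticomm w x, dotProduct_comm x l]
    at wl wx ⊢
  rw [← h2.smul_left_cancel]
  linear_combination (norm := module) -wl - wx

theorem smul_octCross_eq (h2 : IsUnit (2 : R)) (h : IsNullPair l w) (h' : IsNullPair l' w')
    (hlw : l ⬝ᵥ w' = 0) (hwl : w ⬝ᵥ l' = 0) :
    (w ⬝ᵥ w') • octCross l l' = (l ⬝ᵥ l') • octCross w' w := by
  have := h'.skew_octCross h2 l w
  simp only [h.octCross_eq_zero, dotProduct_zero, zero_smul, sub_zero, map_sub, map_smul,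
    map_zero, LinearMap.zero_apply, LinearMap.sub_apply, LinearMap.smul_apply,
    dotProduct_comm w' l, dotProduct_comm l' w, dotProduct_comm l' l, dotProduct_comm w' w, hlw,
    hwl] at this
  linear_combination (norm := module) -this

end IsNullPair

theorem transpose_mem_orthogonalGroup {n : Type*} [Fintype n] [DecidableEq n] {A : Matrix n n R}
    (hA : A ∈ orthogonalGroup n R) : Aᵀ ∈ orthogonalGroup n R := by
  rw [mem_orthogonalGroup_iff, transpose_transpose]
  exact (mem_orthogonalGroup_iff' _ _).mp hA

theorem inv_eq_transpose_of_mem_orthogonalGroup {n : Type*} [Fintype n] [DecidableEq n]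
    {A : Matrix n n R} (hA : A ∈ orthogonalGroup n R) : A⁻¹ = Aᵀ :=
  inv_eq_left_inv ((mem_orthogonalGroup_iff' _ _).mp hA)

/-- Automorphisms of the octonions over `R`, as matrices acting on the imaginary octonions. -/
structure IsOctAut (A : Matrix (Fin 7) (Fin 7) R) : Prop where
  mem_orthogonalGroup : A ∈ orthogonalGroup (Fin 7) R
  mulVec_octCross : ∀ x y, A *ᵥ octCross x y = octCross (A *ᵥ x) (A *ᵥ y)

namespace IsOctAut

variable {A B : Matrix (Fin 7) (Fin 7) R}

theorem mul (hA : IsOctAut A) (hB : IsOctAut B) : IsOctAut (A * B) where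
  mem_orthogonalGroup := mul_mem hA.mem_orthogonalGroup hB.mem_orthogonalGroup
  mulVec_octCross x y := by simp only [← mulVec_mulVec, hB.mulVec_octCross, hA.mulVec_octCross]

theorem transpose (hA : IsOctAut A) : IsOctAut Aᵀ where
  mem_orthogonalGroup := transpose_mem_orthogonalGroup hA.mem_orthogonalGroup
  mulVec_octCross x y := by
    have left_inv (z) : Aᵀ *ᵥ (A *ᵥ z) = z := by
      rw [mulVec_mulVec, (mem_orthogonalGroup_iff' _ _).mp hA.mem_orthogonalGroup, one_mulVec]
    have right_inv (z) : A *ᵥ (Aᵀ *ᵥ z) = z := by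
      rw [mulVec_mulVec, (mem_orthogonalGroup_iff _ _).mp hA.mem_orthogonalGroup, one_mulVec]
    rw [← left_inv (octCross (Aᵀ *ᵥ x) (Aᵀ *ᵥ y)), hA.mulVec_octCross, right_inv, right_inv]

theorem mulVec_octCross_iff :
    (∀ x y, A *ᵥ octCross x y = octCross (A *ᵥ x) (A *ᵥ y)) ↔
      ∀ i j, A *ᵥ octCross (Pi.single i 1) (Pi.single j 1) = octCross (A.col i) (A.col j) := by
  have : (∀ x y, A *ᵥ octCross x y = octCross (A *ᵥ x) (A *ᵥ y)) ↔
      octCross.compr₂ A.mulVecLin = octCross.compl₁₂ A.mulVecLin A.mulVecLin :=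
    ⟨fun h => LinearMap.ext₂ h, fun h => LinearMap.congr_fun₂ h⟩
  rw [this, LinearMap.ext_iff_basis (Pi.basisFun R (Fin 7)) (Pi.basisFun R (Fin 7))]
  simp

end IsOctAut

/-- The exponential of a multiple of the skew map of a null pair, which squares to zero. -/
theorem IsNullPair.isOctAut {l w : Fin 7 → R} (h2 : IsUnit (2 : R)) (h : IsNullPair l w) (s : R) :
    IsOctAut (1 + s • (vecMulVec l w - vecMulVec w l)) where
  mem_orthogonalGroup := by
    rw [mem_orthogonalGroup_iff']
    simp only [transpose_add, transpose_smul, transpose_sub, transpose_vecMulVec, transpose_one,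
      Matrix.mul_add, Matrix.add_mul, Matrix.mul_sub, Matrix.sub_mul, Matrix.smul_mul,
      Matrix.mul_smul, vecMulVec_mul_vecMulVec, h.orth, h.symm.orth, h.left_null, h.right_null,
      Matrix.one_mul, Matrix.mul_one, zero_smul, vecMulVec_zero]
    module
  mulVec_octCross x y := by
    have mulVec_eq (z) : (1 + s • (vecMulVec l w - vecMulVec w l)) *ᵥ z =
        z + s • ((w ⬝ᵥ z) • l - (l ⬝ᵥ z) • w) := by
      simp [add_mulVec, smul_mulVec, sub_mulVec, vecMulVec_mulVec]
    simp only [mulVec_eq, h.skew_octCross h2, map_add, map_sub, map_smul, LinearMap.add_apply,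
      LinearMap.sub_apply, LinearMap.smul_apply, h.octCross_eq_zero, h.symm.octCross_eq_zero,
      octCross_self]
    module

end Cross

section Transfer

variable {R S : Type*} [CommRing R] [CommRing S] {A : Matrix (Fin 7) (Fin 7) R}

theorem map_comp_mulVec {m n : Type*} [Fintype n] (φ : R →+* S) (A : Matrix m n R) (x : n → R) :
    φ ∘ (A *ᵥ x) = A.map φ *ᵥ (φ ∘ x) :=
  funext (RingHom.map_mulVec φ A x)

theorem map_mem_orthogonalGroup {n : Type*} [Fintype n] [DecidableEq n] {A : Matrix n n R}
    (hA : A ∈ orthogonalGroup n R) (φ : R →+* S) : A.map φ ∈ orthogonalGroup n S := by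
  rw [mem_orthogonalGroup_iff] at hA ⊢
  rw [← transpose_map, ← Matrix.map_mul, hA, Matrix.map_one _ (map_zero φ) (map_one φ)]

theorem IsOctAut.map (hA : IsOctAut A) (φ : R →+* S) : IsOctAut (A.map φ) where
  mem_orthogonalGroup := map_mem_orthogonalGroup hA.mem_orthogonalGroup φ
  mulVec_octCross := by
    have map_single (i : Fin 7) : φ ∘ (Pi.single i 1 : Fin 7 → R) = Pi.single i 1 := by
      ext j; simp [Pi.single_apply, apply_ite φ]
    refine IsOctAut.mulVec_octCross_iff.mpr fun i j => ?_
    have := congrArg (φ ∘ ·) (IsOctAut.mulVec_octCross_iff.mp hA.mulVec_octCross i j)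
    rwa [map_comp_mulVec, map_comp_octCross, map_single, map_single, map_comp_octCross] at this

theorem IsOctAut.of_map {ι : Type*} (φ : ι → R →+* S)
    (hφ : ∀ a b, (∀ i, φ i a = φ i b) → a = b) (hA : ∀ i, IsOctAut (A.map (φ i))) :
    IsOctAut A where
  mem_orthogonalGroup := by
    rw [mem_orthogonalGroup_iff]
    ext r c
    refine hφ _ _ fun i => ?_
    have := (mem_orthogonalGroup_iff _ _).mp (hA i).mem_orthogonalGroup
    rw [← transpose_map, ← Matrix.map_mul, ← Matrix.map_one _ (map_zero (φ i)) (map_one (φ i))]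
      at this
    exact congrFun₂ this r c
  mulVec_octCross x y := by
    ext r
    refine hφ _ _ fun i => ?_
    have : φ i ∘ (A *ᵥ octCross x y) = φ i ∘ octCross (A *ᵥ x) (A *ᵥ y) := by
      simp only [map_comp_mulVec, map_comp_octCross, (hA i).mulVec_octCross]
    exact congrFun this r

end Transfer

/-! ### Simple elements of null vectors -/

section SimpleMat

variable {F n : Type*} [Field F] [Fintype n]

/-- The projection `y ↦ (⟨l', y⟩ / ⟨l, l'⟩) l` onto the line of `l` along `l'^⊥`. -/
def nullProj (l l' : n → F) : Matrix n n F := (l ⬝ᵥ l')⁻¹ • vecMulVec l l'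

variable {μ : F} {l l' : n → F}

theorem nullProj_mulVec (l l' y : n → F) :
    nullProj l l' *ᵥ y = ((l' ⬝ᵥ y) / (l ⬝ᵥ l')) • l := by
  simp [nullProj, smul_mulVec, vecMulVec_mulVec, smul_smul, div_eq_inv_mul]

theorem transpose_nullProj (l l' : n → F) : (nullProj l l')ᵀ = nullProj l' l := by
  rw [nullProj, nullProj, transpose_smul, transpose_vecMulVec, dotProduct_comm]

theorem nullProj_mul_nullProj (l l' u u' : n → F) :
    nullProj l l' * nullProj u u' =
      ((l ⬝ᵥ l')⁻¹ * (u ⬝ᵥ u')⁻¹ * (l' ⬝ᵥ u)) • vecMulVec l u' := by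
  simp only [nullProj, Matrix.smul_mul, Matrix.mul_smul, vecMulVec_mul_vecMulVec, vecMulVec_smul,
    smul_smul, ← mul_assoc, mul_comm]

theorem nullProj_mul_self (hn : l ⬝ᵥ l' ≠ 0) : nullProj l l' * nullProj l l' = nullProj l l' := by
  rw [nullProj_mul_nullProj, dotProduct_comm l' l, mul_assoc, inv_mul_cancel₀ hn, mul_one,
    nullProj]

theorem map_nullProj {K : Type*} [Field K] (φ : F →+* K) (l l' : n → F) :
    (nullProj l l').map φ = nullProj (φ ∘ l) (φ ∘ l') := by
  ext i j
  simp [nullProj, vecMulVec_apply, RingHom.map_dotProduct]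

variable [DecidableEq n]

/-- The projection onto `(l ⊕ l')^⊥` along the hyperbolic plane `l ⊕ l'`. -/
def midProj (l l' : n → F) : Matrix n n F := 1 - nullProj l l' - nullProj l' l

/-- The simple element with eigenvalues `μ` on `l`, `μ⁻¹` on `l'` and `1` on `(l ⊕ l')^⊥`. -/
def simpleMat (μ : F) (l l' : n → F) : Matrix n n F :=
  μ⁻¹ • nullProj l' l + midProj l l' + μ • nullProj l l'

theorem midProj_comm (l l' : n → F) : midProj l' l = midProj l l' := by
  rw [midProj, midProj]; abel

theorem transpose_midProj (l l' : n → F) : (midProj l l')ᵀ = midProj l l' := by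
  rw [midProj, transpose_sub, transpose_sub, transpose_one, transpose_nullProj,
    transpose_nullProj]
  abel

theorem midProj_mulVec (l l' y : n → F) :
    midProj l l' *ᵥ y = y - ((l' ⬝ᵥ y) / (l ⬝ᵥ l')) • l - ((l ⬝ᵥ y) / (l ⬝ᵥ l')) • l' := by
  rw [midProj, sub_mulVec, sub_mulVec, one_mulVec, nullProj_mulVec, nullProj_mulVec,
    dotProduct_comm l' l]

theorem dotProduct_midProj_mulVec {l l' : n → F} (h : l ⬝ᵥ l = 0) (hn : l ⬝ᵥ l' ≠ 0) (y : n → F) :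
    l ⬝ᵥ midProj l l' *ᵥ y = 0 := by
  simp [midProj_mulVec, dotProduct_sub, h, hn]

theorem midProj_mulVec_left {l l' : n → F} (h : l ⬝ᵥ l = 0) (hn : l ⬝ᵥ l' ≠ 0) :
    midProj l l' *ᵥ l = 0 := by
  simp [midProj_mulVec, h, hn, dotProduct_comm l' l]

theorem map_midProj {K : Type*} [Field K] (φ : F →+* K) (l l' : n → F) :
    (midProj l l').map φ = midProj (φ ∘ l) (φ ∘ l') := by
  rw [midProj, midProj, ← map_nullProj, ← map_nullProj]
  ext i j
  simp [one_apply, apply_ite φ]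

theorem smul_midProj_mulVec_swap {k k' : n → F} (h : l ⬝ᵥ l = 0) (h' : l' ⬝ᵥ l' = 0)
    (hkl' : k ⬝ᵥ l' = 0) (hlk' : l ⬝ᵥ k' = 0) (hl : l ⬝ᵥ l' ≠ 0) (hk : k ⬝ᵥ k' ≠ 0) :
    (k ⬝ᵥ k') • (midProj k k' *ᵥ l) =
      ((midProj l l' *ᵥ k) ⬝ᵥ (midProj l l' *ᵥ k')) • l -
        (l ⬝ᵥ k) • (midProj l l' *ᵥ k') := by
  simp only [midProj_mulVec, sub_dotProduct, dotProduct_sub, smul_dotProduct, dotProduct_smul,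
    smul_eq_mul, h, h', dotProduct_comm l' k, dotProduct_comm k' l, dotProduct_comm k l,
    dotProduct_comm l' l, hkl', hlk']
  match_scalars <;> field_simp <;> ring

theorem simpleMat_eq (μ : F) (l l' : n → F) :
    simpleMat μ l l' = 1 + (μ⁻¹ - 1) • nullProj l' l + (μ - 1) • nullProj l l' := by
  rw [simpleMat, midProj]; module

theorem transpose_simpleMat (μ : F) (l l' : n → F) :
    (simpleMat μ l l')ᵀ = simpleMat μ l' l := by
  simp only [simpleMat, transpose_add, transpose_smul, transpose_nullProj, transpose_midProj,
    midProj_comm l' l]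

theorem simpleMat_inv (μ : F) (l l' : n → F) : simpleMat μ⁻¹ l l' = simpleMat μ l' l := by
  rw [simpleMat, simpleMat, inv_inv, midProj_comm]; abel

theorem map_simpleMat {K : Type*} [Field K] (φ : F →+* K) (μ : F) (l l' : n → F) :
    (simpleMat μ l l').map φ = simpleMat (φ μ) (φ ∘ l) (φ ∘ l') := by
  simp only [simpleMat_eq, ← map_nullProj]
  ext i j
  simp [one_apply, apply_ite φ]

theorem simpleMat_mem_orthogonalGroup (hμ : μ ≠ 0) (h : l ⬝ᵥ l = 0) (h' : l' ⬝ᵥ l' = 0)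
    (hn : l ⬝ᵥ l' ≠ 0) : simpleMat μ l l' ∈ orthogonalGroup n F := by
  have hn' : l' ⬝ᵥ l ≠ 0 := by rwa [dotProduct_comm]
  rw [mem_orthogonalGroup_iff', transpose_simpleMat]
  simp only [simpleMat_eq, Matrix.mul_add, Matrix.add_mul, Matrix.smul_mul, Matrix.mul_smul,
    nullProj_mul_self hn, nullProj_mul_self hn', nullProj_mul_nullProj l l' l' l,
    nullProj_mul_nullProj l' l l l', h, h', mul_zero, zero_smul, smul_zero, Matrix.mul_one,
    Matrix.one_mul]
  match_scalars <;> field_simp <;> ring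

theorem dotProduct_mulVec_mulVec_of_mem_orthogonalGroup {R : Type*} [CommRing R] {H : Matrix n n R}
    (hH : H ∈ orthogonalGroup n R) (x y : n → R) : H *ᵥ x ⬝ᵥ H *ᵥ y = x ⬝ᵥ y := by
  rw [dotProduct_mulVec, vecMul_mulVec, (mem_orthogonalGroup_iff' _ _).mp hH, vecMul_one]

end SimpleMat

/-! ### Frames -/

section Frame

variable {F m n : Type*} [Field F] [Fintype m] [DecidableEq m] [DecidableEq n]

/-- For dual families of null vectors, the columns of `E` and of `E'`, this is the orthogonal
matrix that acts by `M` on the span of `E`, by `M⁻¹ᵀ` on the span of `E'` and trivially on the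
orthogonal complement of both. -/
noncomputable def frameMat (E E' : Matrix n m F) (M : Matrix m m F) : Matrix n n F :=
  1 + E * (M - 1) * E'ᵀ + E' * (M⁻¹ᵀ - 1) * Eᵀ

theorem frameMat_mul [Fintype n] {E E' : Matrix n m F} (hE : Eᵀ * E = 0) (hE' : E'ᵀ * E' = 0)
    (hEE' : Eᵀ * E' = 1) (M M' : Matrix m m F) :
    frameMat E E' M * frameMat E E' M' = frameMat E E' (M * M') := by
  have hE'E : E'ᵀ * E = 1 := by simpa using congrArg transpose hEE'
  have sub_one_mul (A B : Matrix m m F) : A * B - 1 = (A - 1) + (B - 1) + (A - 1) * (B - 1) := by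
    noncomm_ring
  have contract (U V W Z : Matrix n m F) (A B : Matrix m m F) :
      U * A * Vᵀ * (W * B * Zᵀ) = U * (A * (Vᵀ * W) * B) * Zᵀ := by
    simp only [Matrix.mul_assoc]
  simp only [frameMat, Matrix.mul_inv_rev, transpose_mul, sub_one_mul, Matrix.mul_add,
    Matrix.add_mul, contract, hE, hE', hEE', hE'E, Matrix.mul_zero, Matrix.zero_mul, Matrix.mul_one,
    Matrix.one_mul]
  abel

theorem frameMat_transvection (E E' : Matrix n m F) {i j : m} (hij : i ≠ j) (c : F) :
    frameMat E E' (transvection i j c) =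
      1 + c • (vecMulVec (E.col i) (E'.col j) - vecMulVec (E'.col j) (E.col i)) := by
  have inv : (transvection i j c)⁻¹ = transvection i j (-c) := inv_eq_right_inv <| by
    rw [transvection_mul_transvection_same _ _ hij, add_neg_cancel, transvection_zero]
  have mul_single (U V : Matrix n m F) (k l : m) (d : F) :
      U * single k l d * Vᵀ = d • vecMulVec (U.col k) (V.col l) := by
    rw [← mul_one d, ← smul_eq_mul, ← smul_single, single_eq_single_vecMulVec_single,
      Matrix.mul_smul, Matrix.smul_mul, mul_vecMulVec, vecMulVec_mul, vecMul_transpose,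
      mulVec_single_one, mulVec_single_one, smul_eq_mul, mul_one]
  rw [frameMat, inv, transvection, transvection, transpose_add, transpose_one, transpose_single,
    add_sub_cancel_left, add_sub_cancel_left, mul_single, mul_single]
  module

theorem inv_one_add_smul_vecMulVec {μ : F} (hμ : μ ≠ 0) {x y : m → F} (h : x ⬝ᵥ y ≠ 0) :
    (1 + ((μ⁻¹ - 1) / (x ⬝ᵥ y)) • vecMulVec x y)⁻¹ =
      1 + ((μ - 1) / (x ⬝ᵥ y)) • vecMulVec x y := by
  refine inv_eq_right_inv ?_
  simp only [Matrix.mul_add, Matrix.add_mul, Matrix.smul_mul, Matrix.mul_smul,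
    vecMulVec_mul_vecMulVec, vecMulVec_smul, dotProduct_comm y x, Matrix.mul_one, Matrix.one_mul]
  match_scalars
  · simp
  · field_simp
    ring

theorem det_one_add_smul_vecMulVec (μ : F) {x y : m → F} (h : x ⬝ᵥ y ≠ 0) :
    (1 + ((μ⁻¹ - 1) / (x ⬝ᵥ y)) • vecMulVec x y).det = μ⁻¹ := by
  rw [← smul_vecMulVec, vecMulVec_eq Unit, det_one_add_replicateCol_mul_replicateRow,
    dotProduct_smul, dotProduct_comm y, smul_eq_mul, div_mul_cancel₀ _ h, add_sub_cancel]

theorem simpleMat_mulVec_mulVec [Fintype n] {E E' : Matrix n m F} (hEE' : Eᵀ * E' = 1) {μ : F}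
    (hμ : μ ≠ 0) {x y : m → F} (h : x ⬝ᵥ y ≠ 0) :
    simpleMat μ (E' *ᵥ y) (E *ᵥ x) =
      frameMat E E' (1 + ((μ⁻¹ - 1) / (x ⬝ᵥ y)) • vecMulVec x y) := by
  have pairing : E *ᵥ x ⬝ᵥ E' *ᵥ y = x ⬝ᵥ y := by
    rw [dotProduct_mulVec, vecMul_mulVec, hEE', vecMul_one]
  rw [frameMat, inv_one_add_smul_vecMulVec hμ h, simpleMat_eq, nullProj, nullProj,
    dotProduct_comm (E' *ᵥ y), pairing]
  simp only [add_sub_cancel_left, transpose_add, transpose_one, transpose_smul,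
    transpose_vecMulVec, Matrix.mul_smul, Matrix.smul_mul, mul_vecMulVec, vecMulVec_mul,
    vecMul_transpose, smul_smul, div_eq_mul_inv]

/-- Dual frames of two null planes that are transverse to each other and whose opposite columns
have vanishing octonion product. -/
structure IsOctFrame (E E' : Matrix (Fin 7) (Fin 2) F) : Prop where
  left_null : Eᵀ * E = 0
  right_null : E'ᵀ * E' = 0
  dual : Eᵀ * E' = 1
  octCross_eq_zero : ∀ i j, i ≠ j → octCross (E.col i) (E'.col j) = 0

namespace IsOctFrame

variable {E E' : Matrix (Fin 7) (Fin 2) F}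

theorem isNullPair (h : IsOctFrame E E') {i j : Fin 2} (hij : i ≠ j) :
    IsNullPair (E.col i) (E'.col j) where
  left_null := congrFun₂ h.left_null i i
  orth := (congrFun₂ h.dual i j).trans (one_apply_ne hij)
  right_null := congrFun₂ h.right_null j j
  octCross_eq_zero := h.octCross_eq_zero i j hij

open scoped MatrixGroups in
/-- Transvections act by the unipotent automorphisms of null pairs, and they generate `SL₂`. -/
theorem isOctAut_frameMat (h2 : (2 : F) ≠ 0) (h : IsOctFrame E E') {M : Matrix (Fin 2) (Fin 2) F}
    (hM : M.det = 1) : IsOctAut (frameMat E E' M) := by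
  suffices ∀ g : SL(2, F), IsOctAut (frameMat E E' (g : Matrix (Fin 2) (Fin 2) F)) from
    this ⟨M, hM⟩
  refine SL2.transvection_induction _ (fun i j hij c => ?_) fun A B hA hB => ?_
  · rw [SpecialLinearGroup.transvection_coe, ← transvection, frameMat_transvection E E' hij]
    exact (h.isNullPair hij).isOctAut (IsUnit.mk0 _ h2) c
  · exact frameMat_mul h.left_null h.right_null h.dual _ _ ▸ hA.mul hB

end IsOctFrame

theorem of_mul_transpose_of_fin_two {R : Type*} [CommRing R] {n : Type*} [Fintype n]
    (a b c d : n → R) :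
    of ![a, b] * (of ![c, d])ᵀ = !![a ⬝ᵥ c, a ⬝ᵥ d; b ⬝ᵥ c, b ⬝ᵥ d] := by
  ext i j
  fin_cases i <;> fin_cases j <;> rfl

theorem transpose_of_mulVec_fin_two {R : Type*} [CommRing R] {n : Type*} (a b : n → R) (x y : R) :
    (of ![a, b])ᵀ *ᵥ ![x, y] = x • a + y • b := by
  ext; simp [mulVec, dotProduct, mul_comm]

theorem isOctFrame_of_isNullPair {l l' w w' : Fin 7 → F} (hlw : IsNullPair l w)
    (hlw' : IsNullPair l' w') (hl : l ⬝ᵥ l' ≠ 0) (hw : w ⬝ᵥ w' ≠ 0) (h : l ⬝ᵥ w' = 0)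
    (h' : l' ⬝ᵥ w = 0) :
    IsOctFrame (of ![l, (w ⬝ᵥ w')⁻¹ • w'])ᵀ (of ![(l ⬝ᵥ l')⁻¹ • l', w])ᵀ where
  left_null := by
    rw [transpose_transpose, of_mul_transpose_of_fin_two]
    simp [hlw.left_null, hlw'.right_null, h, dotProduct_comm w' l, ← Matrix.ext_iff]
  right_null := by
    rw [transpose_transpose, of_mul_transpose_of_fin_two]
    simp [hlw.right_null, hlw'.left_null, h', dotProduct_comm w l', ← Matrix.ext_iff]
  dual := by
    rw [transpose_transpose, of_mul_transpose_of_fin_two, one_fin_two]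
    simp [hlw.orth, hlw'.symm.orth, hl, hw, dotProduct_comm w' w]
  octCross_eq_zero i j hij := by
    fin_cases i <;> fin_cases j <;>
      simp_all [hlw.octCross_eq_zero, hlw'.symm.octCross_eq_zero]

/-- In the dual frame built from the two null pairs, the second factor acts on each null plane by
a matrix whose determinant is inverse to that of the first factor. -/
theorem isOctAut_simpleMat_mul_simpleMat (h2 : (2 : F) ≠ 0) {μ a a' : F} (hμ : μ ≠ 0)
    {l l' w w' : Fin 7 → F} (hlw : IsNullPair l w) (hlw' : IsNullPair l' w')
    (hl : l ⬝ᵥ l' ≠ 0) (hw : w ⬝ᵥ w' ≠ 0) (h : l ⬝ᵥ w' = 0) (h' : l' ⬝ᵥ w = 0)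
    (hk : (w + a • l') ⬝ᵥ (w' + a' • l) ≠ 0) :
    IsOctAut (simpleMat μ l l' * simpleMat μ (w + a • l') (w' + a' • l)) := by
  have frame := isOctFrame_of_isNullPair hlw hlw' hl hw h h'
  set E := (of ![l, (w ⬝ᵥ w')⁻¹ • w'])ᵀ
  set E' := (of ![(l ⬝ᵥ l')⁻¹ • l', w])ᵀ
  have eq_l : E *ᵥ ![1, 0] = l := by simp [E, transpose_of_mulVec_fin_two]
  have eq_l' : E' *ᵥ ![l ⬝ᵥ l', 0] = l' := by simp [E', transpose_of_mulVec_fin_two, smul_smul, hl]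
  have eq_k : E' *ᵥ ![a * (l ⬝ᵥ l'), 1] = w + a • l' := by
    simp [E', transpose_of_mulVec_fin_two, smul_smul, hl, add_comm]
  have eq_k' : E *ᵥ ![a', w ⬝ᵥ w'] = w' + a' • l := by
    simp [E, transpose_of_mulVec_fin_two, smul_smul, hw, add_comm]
  have pairing : ![a', w ⬝ᵥ w'] ⬝ᵥ ![a * (l ⬝ᵥ l'), 1] ≠ 0 := by
    convert hk using 1
    simp [hlw.symm.orth, hlw'.orth, dotProduct_comm l' l]; ring
  have pairing_l : ![1, 0] ⬝ᵥ ![l ⬝ᵥ l', 0] ≠ 0 := by simpa using hl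
  have first := simpleMat_mulVec_mulVec frame.dual (inv_ne_zero hμ) pairing_l
  have second := simpleMat_mulVec_mulVec frame.dual hμ pairing
  rw [eq_l, eq_l', simpleMat_inv] at first
  rw [eq_k, eq_k'] at second
  rw [first, second, frameMat_mul frame.left_null frame.right_null frame.dual]
  refine frame.isOctAut_frameMat h2 ?_
  rw [det_mul, det_one_add_smul_vecMulVec _ pairing_l, det_one_add_smul_vecMulVec _ pairing,
    inv_inv, mul_inv_cancel₀ hμ]

end Frame

/-! ### Complex octonion automorphisms in coordinates -/

theorem octProd_eq (x y : C7) : octProd x y = WithLp.toLp 2 (octCross x.ofLp y.ofLp) := by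
  ext k
  fin_cases k <;>
    simp [octProd, octCross_apply, octCoeff, octTable, Fin.sum_univ_succ] <;> ring

theorem bil_eq (x y : C7) : bil x y = x.ofLp ⬝ᵥ y.ofLp := rfl

theorem act_eq (A : Mat7) (x : C7) : act A x = WithLp.toLp 2 (A *ᵥ x.ofLp) := rfl

theorem mem_orthogonalGroup_iff_dotProduct {R n : Type*} [CommRing R] [Fintype n] [DecidableEq n]
    {A : Matrix n n R} :
    A ∈ orthogonalGroup n R ↔ ∀ x y, A *ᵥ x ⬝ᵥ A *ᵥ y = x ⬝ᵥ y := by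
  refine ⟨dotProduct_mulVec_mulVec_of_mem_orthogonalGroup, fun h => ?_⟩
  rw [mem_orthogonalGroup_iff']
  refine ext_of_mulVec_single fun j => dotProduct_eq _ _ fun x => ?_
  rw [dotProduct_comm, ← mulVec_mulVec, dotProduct_mulVec, vecMul_transpose, h, one_mulVec,
    dotProduct_comm]

theorem mem_G2_iff {A : Mat7} : A ∈ G2 ↔ IsOctAut A := by
  constructor
  · rintro ⟨-, h⟩
    have aut (x y) := h (0, WithLp.toLp 2 x) (0, WithLp.toLp 2 y)
    refine ⟨mem_orthogonalGroup_iff_dotProduct.mpr fun x y => ?_, fun x y => ?_⟩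
    · simpa [octMul, bil_eq, act_eq] using congrArg Prod.fst (aut x y)
    · simpa [octMul, octProd_eq, act_eq] using congrArg (fun p => p.2.ofLp) (aut x y).symm
  · intro h
    have orth := mem_orthogonalGroup_iff_dotProduct.mp h.mem_orthogonalGroup
    refine ⟨IsUnit.of_mul_eq_one _ ((mem_orthogonalGroup_iff _ _).mp h.mem_orthogonalGroup),
      fun p q => Prod.ext ?_ ?_⟩
    · simp [octMul, bil_eq, act_eq, orth]
    · simp only [octMul, map_add, map_smul]
      simp [octProd_eq, act_eq, h.mulVec_octCross]

/-! ### Rational functions regular at a point -/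

section Regular

variable {K : Type*} [Field K]

/-- The ring of rational functions without pole at `z`. -/
def regularSubring (z : K) : Subring (RatFunc K) where
  carrier := {f | f.denom.eval z ≠ 0}
  mul_mem' {f g} hf hg h0 := mul_ne_zero hf hg (by
    rw [← Polynomial.eval_mul]
    exact Polynomial.eval_eq_zero_of_dvd_of_eval_eq_zero (RatFunc.denom_mul_dvd f g) h0)
  add_mem' {f g} hf hg h0 := mul_ne_zero hf hg (by
    rw [← Polynomial.eval_mul]
    exact Polynomial.eval_eq_zero_of_dvd_of_eval_eq_zero (RatFunc.denom_add_dvd f g) h0)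
  one_mem' := by simp
  zero_mem' := by simp
  neg_mem' {f} hf h0 := hf (by
    have dvd := RatFunc.denom_mul_dvd (RatFunc.C (-1 : K)) f
    rw [RatFunc.denom_C, one_mul, map_neg, map_one, neg_one_mul] at dvd
    exact Polynomial.eval_eq_zero_of_dvd_of_eval_eq_zero dvd h0)

/-- Evaluation at `z` of rational functions without pole at `z`. -/
noncomputable def evalRegular (z : K) : regularSubring z →+* K where
  toFun f := f.1.eval (RingHom.id K) z
  map_one' := RatFunc.eval_one _ _
  map_zero' := RatFunc.eval_zero _ _
  map_mul' f g := RatFunc.eval_mul _ _ f.2 g.2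
  map_add' f g := RatFunc.eval_add _ _ f.2 g.2

theorem evalRegular_apply {z : K} (f : regularSubring z) :
    evalRegular z f = f.1.eval (RingHom.id K) z := rfl

theorem evalRegular_eq_zero_iff {z : K} (f : regularSubring z) :
    evalRegular z f = 0 ↔ f.1.num.IsRoot z := by
  rw [evalRegular_apply, RatFunc.eval, Polynomial.eval₂_id, Polynomial.eval₂_id, div_eq_zero_iff,
    or_iff_left f.2, Polynomial.IsRoot.def]

theorem div_mem_regularSubring {z : K} (p : Polynomial K) {q : Polynomial K} (hq : q.eval z ≠ 0) :
    algebraMap _ (RatFunc K) p / algebraMap _ (RatFunc K) q ∈ regularSubring z := fun h0 =>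
  hq (Polynomial.eval_eq_zero_of_dvd_of_eval_eq_zero (RatFunc.denom_div_dvd p q) h0)

theorem algebraMap_mem_regularSubring (z : K) (p : Polynomial K) :
    algebraMap _ (RatFunc K) p ∈ regularSubring z := by
  simpa using div_mem_regularSubring p (q := 1) (z := z) (by simp)

theorem C_mem_regularSubring (z c : K) : RatFunc.C c ∈ regularSubring z :=
  RatFunc.algebraMap_C c ▸ algebraMap_mem_regularSubring z (Polynomial.C c)

theorem X_sub_C_eq_algebraMap (c : K) : (RatFunc.X - RatFunc.C c : RatFunc K) =
    algebraMap (Polynomial K) _ (Polynomial.X - Polynomial.C c) := by simp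

theorem X_sub_C_mem_regularSubring (z c : K) : RatFunc.X - RatFunc.C c ∈ regularSubring z :=
  X_sub_C_eq_algebraMap c ▸ algebraMap_mem_regularSubring z _

theorem eval_X_sub_C (z c : K) :
    (RatFunc.X - RatFunc.C c : RatFunc K).eval (RingHom.id K) z = z - c := by
  rw [X_sub_C_eq_algebraMap, RatFunc.eval_algebraMap]
  simp

theorem X_sub_C_ne_zero (c : K) : (RatFunc.X - RatFunc.C c : RatFunc K) ≠ 0 :=
  X_sub_C_eq_algebraMap c ▸ RatFunc.algebraMap_ne_zero (Polynomial.X_sub_C_ne_zero c)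

theorem eval_div_of_mem {z : K} {f g : RatFunc K} (hg : g ∈ regularSubring z)
    (hfg : f / g ∈ regularSubring z) (h0 : g.eval (RingHom.id K) z ≠ 0) :
    (f / g).eval (RingHom.id K) z = f.eval (RingHom.id K) z / g.eval (RingHom.id K) z := by
  have hg0 : g ≠ 0 := by rintro rfl; exact h0 (RatFunc.eval_zero _ _)
  have := (evalRegular z).map_mul ⟨_, hfg⟩ ⟨_, hg⟩
  simp only [evalRegular_apply, MulMemClass.mk_mul_mk, div_mul_cancel₀ _ hg0] at this
  exact eq_div_of_mul_eq h0 this.symm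

theorem inv_mem_regularSubring {z : K} {f : RatFunc K} (hf : f.eval (RingHom.id K) z ≠ 0) :
    f⁻¹ ∈ regularSubring z := by
  have h0 : f.num.eval z ≠ 0 := by
    intro h
    apply hf
    rw [RatFunc.eval, Polynomial.eval₂_id, h, zero_div]
  rw [← RatFunc.num_div_denom f, inv_div]
  exact div_mem_regularSubring _ h0

theorem exists_eq_mul_of_eval_eq_zero {z : K} {f : RatFunc K} (hf : f ∈ regularSubring z)
    (h0 : f.eval (RingHom.id K) z = 0) :
    ∃ g ∈ regularSubring z, f = (RatFunc.X - RatFunc.C z) * g := by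
  obtain ⟨r, hr⟩ := Polynomial.dvd_iff_isRoot.mpr ((evalRegular_eq_zero_iff ⟨f, hf⟩).mp h0)
  refine ⟨_, div_mem_regularSubring r hf, ?_⟩
  conv_lhs => rw [← RatFunc.num_div_denom f, hr]
  simp [mul_div_assoc]

theorem eq_of_eval_eq_of_infinite {f g : RatFunc K} {S : Set K} (hS : S.Infinite)
    (hf : ∀ z ∈ S, f ∈ regularSubring z) (hg : ∀ z ∈ S, g ∈ regularSubring z)
    (h : ∀ z ∈ S, f.eval (RingHom.id K) z = g.eval (RingHom.id K) z) : f = g := by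
  rw [← sub_eq_zero, ← RatFunc.num_eq_zero_iff]
  refine Polynomial.eq_zero_of_infinite_isRoot _ (hS.mono fun z hz => ?_)
  refine (evalRegular_eq_zero_iff ((⟨f, hf z hz⟩ : regularSubring z) - ⟨g, hg z hz⟩)).mp ?_
  rw [map_sub, sub_eq_zero]
  exact h z hz

theorem finite_setOf_notMem_regularSubring (f : RatFunc K) : {z | f ∉ regularSubring z}.Finite :=
  (Polynomial.finite_setOfPred_isRoot (RatFunc.denom_ne_zero f)).subset fun _ hz => not_not.mp hz

end Regular

/-! ### Regular matrices and their values -/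

theorem RegularAt.exists_lift {g : RatMat} {z : ℂ} (hg : RegularAt g z) :
    ∃ G : Matrix (Fin 7) (Fin 7) (regularSubring z),
      G.map (regularSubring z).subtype = g ∧ G.map (evalRegular z) = value g z :=
  ⟨fun i j => ⟨g i j, hg i j⟩, rfl, rfl⟩

theorem value_map_subtype {z : ℂ} (G : Matrix (Fin 7) (Fin 7) (regularSubring z)) :
    value (G.map (regularSubring z).subtype) z = G.map (evalRegular z) := rfl

theorem RegularAt.mul {g h : RatMat} {z : ℂ} (hg : RegularAt g z) (hh : RegularAt h z) :
    RegularAt (g * h) z := (regularSubring z).matrix.mul_mem hg hh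

theorem RegularAt.add {g h : RatMat} {z : ℂ} (hg : RegularAt g z) (hh : RegularAt h z) :
    RegularAt (g + h) z := (regularSubring z).matrix.add_mem hg hh

theorem RegularAt.smul {g : RatMat} {z : ℂ} {c : RatFunc ℂ} (hc : c ∈ regularSubring z)
    (hg : RegularAt g z) : RegularAt (c • g) z := fun i j =>
  (regularSubring z).mul_mem hc (hg i j)

theorem RegularAt.transpose {g : RatMat} {z : ℂ} (hg : RegularAt g z) : RegularAt gᵀ z :=
  fun i j => hg j i

theorem regularAt_constMat (A : Mat7) (z : ℂ) : RegularAt (constMat A) z :=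
  fun i j => C_mem_regularSubring z (A i j)

theorem value_mul {g h : RatMat} {z : ℂ} (hg : RegularAt g z) (hh : RegularAt h z) :
    value (g * h) z = value g z * value h z := by
  obtain ⟨G, rfl, hG⟩ := hg.exists_lift
  obtain ⟨H, rfl, hH⟩ := hh.exists_lift
  rw [← Matrix.map_mul, value_map_subtype, Matrix.map_mul, hG, hH]

theorem value_smul {g : RatMat} {z : ℂ} {c : RatFunc ℂ} (hc : c ∈ regularSubring z)
    (hg : RegularAt g z) : value (c • g) z = c.eval (RingHom.id ℂ) z • value g z := by
  ext i j
  exact RatFunc.eval_mul _ _ hc (hg i j)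

theorem value_add {g h : RatMat} {z : ℂ} (hg : RegularAt g z) (hh : RegularAt h z) :
    value (g + h) z = value g z + value h z := by
  ext i j
  exact RatFunc.eval_add _ _ (hg i j) (hh i j)

theorem value_constMat (A : Mat7) (z : ℂ) : value (constMat A) z = A := by
  ext i j; simp [value, constMat]

theorem value_transpose (g : RatMat) (z : ℂ) : value gᵀ z = (value g z)ᵀ := rfl

theorem det_value {g : RatMat} {z : ℂ} (hg : RegularAt g z) :
    (value g z).det = g.det.eval (RingHom.id ℂ) z := by
  obtain ⟨G, rfl, hG⟩ := hg.exists_lift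
  rw [← hG]
  exact ((evalRegular z).map_det G).symm.trans
    (congrArg (RatFunc.eval _ z) ((regularSubring z).subtype.map_det G))

theorem value_mem_orthogonalGroup {g : RatMat} (h : g ∈ orthogonalGroup (Fin 7) (RatFunc ℂ))
    {z : ℂ} (hg : RegularAt g z) : value g z ∈ orthogonalGroup (Fin 7) ℂ := by
  rw [mem_orthogonalGroup_iff] at h ⊢
  rw [← value_transpose, ← value_mul hg hg.transpose, h,
    ← Matrix.map_one RatFunc.C (map_zero _) (map_one _)]
  exact value_constMat 1 z

theorem IsOctAut.value {g : RatMat} (h : IsOctAut g) {z : ℂ} (hg : RegularAt g z) :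
    IsOctAut (value g z) := by
  obtain ⟨G, rfl, hG⟩ := hg.exists_lift
  rw [← hG]
  exact (IsOctAut.of_map (fun _ : Unit => (regularSubring z).subtype)
    (fun _ _ h => Subtype.ext (h ())) fun _ => h).map _

theorem isOctAut_of_infinite {g : RatMat} {S : Set ℂ} (hS : S.Infinite)
    (h : ∀ z ∈ S, HolomorphicAt G2 g z) : IsOctAut g := by
  let O : Subring (RatFunc ℂ) := ⨅ z ∈ S, regularSubring z
  have le (z : S) : O ≤ regularSubring z.1 := iInf₂_le z.1 z.2
  let G : Matrix (Fin 7) (Fin 7) O := fun i j =>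
    ⟨g i j, Subring.mem_iInf.mpr fun z => Subring.mem_iInf.mpr fun hz => (h z hz).1 i j⟩
  refine (IsOctAut.of_map (A := G) (fun z : S => (evalRegular z.1).comp (Subring.inclusion (le z)))
    (fun a b hab => Subtype.ext ?_) fun z => mem_G2_iff.mp (h z z.2).2).map O.subtype
  exact eq_of_eval_eq_of_infinite hS (fun z hz => le ⟨z, hz⟩ a.2) (fun z hz => le ⟨z, hz⟩ b.2)
    fun z hz => hab ⟨z, hz⟩

theorem finite_setOf_not_regularAt (g : RatMat) : {z | ¬ RegularAt g z}.Finite := by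
  refine (Set.finite_iUnion fun i => Set.finite_iUnion fun j =>
    finite_setOf_notMem_regularSubring (g i j)).subset fun z hz => ?_
  obtain ⟨i, hi⟩ := not_forall.mp hz
  obtain ⟨j, hj⟩ := not_forall.mp hi
  exact Set.mem_iUnion₂.mpr ⟨i, j, hj⟩

theorem eventually_regularAt (g : RatMat) : ∀ᶠ z in Bornology.cobounded ℂ, RegularAt g z := by
  have := (finite_setOf_not_regularAt g).isBounded
  rw [Bornology.isBounded_def] at this
  filter_upwards [this] with z hz
  exact not_not.mp hz

/-! ### Conjugation of coefficients -/

/-- Complex conjugation of the coefficients of a rational function; the real rational loops are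
its fixed points. -/
noncomputable def ratConj : RatFunc ℂ →+* RatFunc ℂ :=
  RatFunc.mapRingHom (Polynomial.mapRingHom (starRingEnd ℂ))
    (nonZeroDivisors_le_comap_nonZeroDivisors_of_injective _
      (Polynomial.map_injective _ (starRingEnd ℂ).injective))

theorem ratConj_algebraMap (p : Polynomial ℂ) :
    ratConj (algebraMap _ (RatFunc ℂ) p) = algebraMap _ _ (p.map (starRingEnd ℂ)) := by
  have := RatFunc.map_apply_div (Polynomial.mapRingHom (starRingEnd ℂ))
    (nonZeroDivisors_le_comap_nonZeroDivisors_of_injective _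
      (Polynomial.map_injective _ (starRingEnd ℂ).injective)) p 1
  simp only [map_one, div_one] at this
  exact this

theorem ratConj_X_sub_C (c : ℂ) :
    ratConj (RatFunc.X - RatFunc.C c) = RatFunc.X - RatFunc.C (starRingEnd ℂ c) := by
  rw [X_sub_C_eq_algebraMap, ratConj_algebraMap, X_sub_C_eq_algebraMap]
  simp

theorem ratConj_C (c : ℂ) : ratConj (RatFunc.C c) = RatFunc.C (starRingEnd ℂ c) := by
  rw [← RatFunc.algebraMap_C, ratConj_algebraMap, Polynomial.map_C, RatFunc.algebraMap_C]

theorem ratConj_eq_div (f : RatFunc ℂ) : ratConj f =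
    algebraMap _ _ (f.num.map (starRingEnd ℂ)) / algebraMap _ _ (f.denom.map (starRingEnd ℂ)) := by
  conv_lhs => rw [← RatFunc.num_div_denom f]
  rw [map_div₀, ratConj_algebraMap, ratConj_algebraMap]

theorem ratConj_mem_regularSubring {z : ℂ} {f : RatFunc ℂ} (hf : f ∈ regularSubring z) :
    ratConj f ∈ regularSubring (starRingEnd ℂ z) := by
  rw [ratConj_eq_div]
  refine div_mem_regularSubring _ ?_
  rw [Polynomial.eval_map_apply]
  exact (map_ne_zero _).mpr hf

theorem eval_ratConj {z : ℂ} {f : RatFunc ℂ} (hf : f ∈ regularSubring z) :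
    (ratConj f).eval (RingHom.id ℂ) (starRingEnd ℂ z) =
      starRingEnd ℂ (f.eval (RingHom.id ℂ) z) := by
  have eval_conj (p : Polynomial ℂ) : (algebraMap _ (RatFunc ℂ) (p.map (starRingEnd ℂ))).eval
      (RingHom.id ℂ) (starRingEnd ℂ z) = starRingEnd ℂ (p.eval z) := by
    rw [RatFunc.eval_algebraMap, Algebra.algebraMap_self, RingHom.id_apply, Polynomial.eval₂_id,
      Polynomial.eval_map_apply]
  have mem := ratConj_mem_regularSubring hf
  rw [ratConj_eq_div] at mem ⊢
  rw [eval_div_of_mem (algebraMap_mem_regularSubring _ _) mem, eval_conj, eval_conj, RatFunc.eval,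
    map_div₀, Polynomial.eval₂_id, Polynomial.eval₂_id]
  rw [eval_conj]
  exact (map_ne_zero _).mpr hf

theorem RegularAt.map_ratConj {g : RatMat} {z : ℂ} (hg : RegularAt g z) :
    RegularAt (g.map ratConj) (starRingEnd ℂ z) := fun i j => ratConj_mem_regularSubring (hg i j)

theorem value_map_ratConj {g : RatMat} {z : ℂ} (hg : RegularAt g (starRingEnd ℂ z)) :
    value (g.map ratConj) z = (value g (starRingEnd ℂ z)).map (starRingEnd ℂ) := by
  ext i j
  have := eval_ratConj (hg i j)
  rwa [Complex.conj_conj] at this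

theorem regularAt_conj_iff {g : RatMat} (hg : g.map ratConj = g) {z : ℂ} :
    RegularAt g (starRingEnd ℂ z) ↔ RegularAt g z := by
  refine ⟨fun h => ?_, fun h => hg ▸ h.map_ratConj⟩
  simpa only [hg, Complex.conj_conj] using h.map_ratConj

theorem HasSimplePoleAt.conj {g : RatMat} (hg : g.map ratConj = g) {z : ℂ}
    (h : HasSimplePoleAt g z) : HasSimplePoleAt g (starRingEnd ℂ z) := by
  refine ⟨mt (regularAt_conj_iff hg).mp h.1, ?_⟩
  convert h.2.map_ratConj using 1
  ext i j
  change _ = ratConj (_ * g i j)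
  rw [map_mul, ratConj_X_sub_C, ← Matrix.map_apply (f := ratConj), hg]
  rfl

/-! ### Negative real loops -/

/-- The algebraic form of `IsNegRealLoop G2`: both the automorphism property and the reality
condition are identities between rational functions. -/
structure IsNegRealOctLoop (g : RatMat) : Prop where
  isOctAut : IsOctAut g
  map_ratConj : g.map ratConj = g
  tendsto_one : Tendsto (value g) (Bornology.cobounded ℂ) (nhds 1)

theorem infinite_regularAt_and_regularAt_conj {U : Set ℂ} (hU : IsOpen U) (hd : U.Nonempty)
    (g : RatMat) : {z ∈ U | RegularAt g z ∧ RegularAt g (starRingEnd ℂ z)}.Infinite := by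
  obtain ⟨z, hz⟩ := hd
  have finite := finite_setOf_not_regularAt g
  refine ((infinite_of_mem_nhds z (hU.mem_nhds hz)).sdiff
    (finite.union (finite.preimage (starRingEnd ℂ).injective.injOn))).mono fun w hw => ?_
  have := hw.2
  simp only [Set.mem_union, Set.mem_preimage, Set.mem_ofPred_eq, not_or, not_not] at this
  exact ⟨hw.1, this⟩

theorem IsNegRealLoop.isNegRealOctLoop {g : RatMat} (h : IsNegRealLoop G2 g) :
    IsNegRealOctLoop g := by
  obtain ⟨U, hU, hd, hol⟩ := h.loop
  have hS := infinite_regularAt_and_regularAt_conj hU hd.nonempty g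
  refine ⟨isOctAut_of_infinite hS fun z hz => hol z hz.1, ?_, h.neg⟩
  ext i j
  refine eq_of_eval_eq_of_infinite hS (fun z hz => ?_) (fun z hz => hz.2.1 i j) fun z hz => ?_
  · have := hz.2.2.map_ratConj
    rw [Complex.conj_conj] at this
    exact this i j
  · exact congrFun₂ ((value_map_ratConj hz.2.2).trans (h.real z hz.2.1 hz.2.2)) i j

theorem IsNegRealOctLoop.holomorphicAt {g : RatMat} (h : IsNegRealOctLoop g) {z : ℂ}
    (hz : RegularAt g z) : HolomorphicAt G2 g z :=
  ⟨hz, mem_G2_iff.mpr (h.isOctAut.value hz)⟩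

theorem IsNegRealOctLoop.isNegRealLoop {g : RatMat} (h : IsNegRealOctLoop g) :
    IsNegRealLoop G2 g where
  loop := ⟨{z | ¬ RegularAt g z}ᶜ, (finite_setOf_not_regularAt g).isClosed.isOpen_compl,
    (finite_setOf_not_regularAt g).countable.dense_compl ℂ, fun _ hz =>
      h.holomorphicAt (not_not.mp hz)⟩
  real z _ hz := by rw [← value_map_ratConj hz, h.map_ratConj]
  neg := h.tendsto_one

theorem tendsto_value_mul {g h : RatMat}
    (hg : Tendsto (value g) (Bornology.cobounded ℂ) (nhds 1))
    (hh : Tendsto (value h) (Bornology.cobounded ℂ) (nhds 1)) :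
    Tendsto (value (g * h)) (Bornology.cobounded ℂ) (nhds 1) := by
  refine (Matrix.one_mul (1 : Mat7) ▸ hg.mul hh).congr' ?_
  filter_upwards [eventually_regularAt g, eventually_regularAt h] with z h1 h2
  exact (value_mul h1 h2).symm

theorem tendsto_value_transpose {g : RatMat}
    (hg : Tendsto (value g) (Bornology.cobounded ℂ) (nhds 1)) :
    Tendsto (value gᵀ) (Bornology.cobounded ℂ) (nhds 1) :=
  (continuous_id.matrix_transpose.tendsto' (1 : Mat7) 1 transpose_one).comp hg

theorem IsNegRealOctLoop.mul {g h : RatMat} (hg : IsNegRealOctLoop g) (hh : IsNegRealOctLoop h) :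
    IsNegRealOctLoop (g * h) where
  isOctAut := hg.isOctAut.mul hh.isOctAut
  map_ratConj := by rw [Matrix.map_mul, hg.map_ratConj, hh.map_ratConj]
  tendsto_one := tendsto_value_mul hg.tendsto_one hh.tendsto_one

theorem IsNegRealOctLoop.transpose {g : RatMat} (hg : IsNegRealOctLoop g) :
    IsNegRealOctLoop gᵀ where
  isOctAut := hg.isOctAut.transpose
  map_ratConj := by rw [transpose_map, hg.map_ratConj]
  tendsto_one := tendsto_value_transpose hg.tendsto_one

theorem det_eq_one_of_tendsto {g : RatMat} (hg : g ∈ orthogonalGroup (Fin 7) (RatFunc ℂ))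
    (hn : Tendsto (value g) (Bornology.cobounded ℂ) (nhds 1)) : g.det = 1 := by
  have sq : g.det * g.det = 1 := by
    simpa only [det_mul, det_transpose, det_one] using
      congrArg det ((mem_orthogonalGroup_iff _ _).mp hg)
  refine (mul_self_eq_one_iff.mp sq).resolve_right fun hneg => ?_
  have tendsto_det : Tendsto (fun A : Mat7 => A.det) (nhds 1) (nhds 1) :=
    (continuous_id.matrix_det).tendsto' _ _ det_one
  have tendsto_neg_one : Tendsto (fun _ : ℂ => (-1 : ℂ)) (Bornology.cobounded ℂ) (nhds 1) := by
    refine (tendsto_det.comp hn).congr' ?_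
    filter_upwards [eventually_regularAt g] with z hz
    rw [Function.comp_apply, det_value hz, hneg, ← map_one RatFunc.C, ← map_neg, RatFunc.eval_C,
      RingHom.id_apply]
  have := tendsto_nhds_unique tendsto_neg_one tendsto_const_nhds
  norm_num at this

theorem value_mem_SO7 {g : RatMat} (hg : g ∈ orthogonalGroup (Fin 7) (RatFunc ℂ))
    (hdet : g.det = 1) {z : ℂ} (hz : RegularAt g z) : value g z ∈ SO7 :=
  ⟨(mem_orthogonalGroup_iff' _ _).mp (value_mem_orthogonalGroup hg hz), by
    rw [det_value hz, hdet, RatFunc.eval_one]⟩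

/-! ### Isotropic lines in coordinates -/

/-- The line spanned by a coordinate vector. -/
noncomputable def line (l : Fin 7 → ℂ) : Submodule ℂ C7 := Submodule.span ℂ {WithLp.toLp 2 l}

theorem mem_line {l : Fin 7 → ℂ} {x : C7} : x ∈ line l ↔ ∃ c : ℂ, x = WithLp.toLp 2 (c • l) := by
  rw [line, Submodule.mem_span_singleton]
  exact exists_congr fun c => eq_comm

theorem line_le_iff {l : Fin 7 → ℂ} {W : Submodule ℂ C7} : line l ≤ W ↔ WithLp.toLp 2 l ∈ W :=
  Submodule.span_singleton_le_iff_mem _ _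

theorem map_line (f : C7 →ₗ[ℂ] C7) (l : Fin 7 → ℂ) :
    (line l).map f = line (f (WithLp.toLp 2 l)).ofLp := by
  rw [line, Submodule.map_span, Set.image_singleton]; rfl

theorem conjSub_line (l : Fin 7 → ℂ) : conjSub (line l) = line (star l) := by
  ext x
  have conj_smul (y : C7) (c : ℂ) :
      conjVec y = WithLp.toLp 2 (c • l) ↔ y = WithLp.toLp 2 (star c • star l) := by
    simp only [WithLp.ext_iff, funext_iff, conjVec]
    exact forall_congr' fun i =>
      ⟨fun h => by simpa using congrArg star h, fun h => by simp [h]⟩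
  change conjVec x ∈ line l ↔ _
  simp only [mem_line, conj_smul]
  exact ⟨fun ⟨c, hc⟩ => ⟨star c, hc⟩, fun ⟨c, hc⟩ => ⟨star c, by rwa [star_star]⟩⟩

open scoped ComplexOrder in
theorem dotProduct_star_self_ne_zero {n : Type*} [Fintype n] {l : n → ℂ} (hl : l ≠ 0) :
    l ⬝ᵥ star l ≠ 0 :=
  fun h => hl (dotProduct_self_star_eq_zero.mp h)

theorem star_dotProduct_star_eq_zero {n : Type*} [Fintype n] {x y : n → ℂ} (h : x ⬝ᵥ y = 0) :
    star x ⬝ᵥ star y = 0 := by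
  rw [star_dotProduct_star, dotProduct_comm, h, star_zero]

theorem isIsotropicLine_line {l : Fin 7 → ℂ} (hl : l ≠ 0) (h0 : l ⬝ᵥ l = 0) :
    IsIsotropicLine (line l) := by
  refine ⟨finrank_span_singleton fun h => hl (congrArg WithLp.ofLp h), fun x hx y hy => ?_⟩
  obtain ⟨c, rfl⟩ := mem_line.mp hx
  obtain ⟨d, rfl⟩ := mem_line.mp hy
  simp [bil_eq, h0]

theorem IsIsotropicLine.exists_eq_line {L : Submodule ℂ C7} (h : IsIsotropicLine L) :
    ∃ l : Fin 7 → ℂ, l ≠ 0 ∧ l ⬝ᵥ l = 0 ∧ L = line l := by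
  obtain ⟨v, hv, hL⟩ := finrank_eq_one_iff'.mp h.1
  refine ⟨v.1.ofLp, fun h => hv (Subtype.ext (WithLp.ofLp_injective 2 h)),
    h.2 v.1 v.2 v.1 v.2, le_antisymm (fun x hx => ?_) (line_le_iff.mpr v.2)⟩
  obtain ⟨c, hc⟩ := hL ⟨x, hx⟩
  exact mem_line.mpr ⟨c, (congrArg Subtype.val hc).symm⟩

theorem mem_bilPerp_line {l : Fin 7 → ℂ} {x : C7} :
    x ∈ bilPerp (line l) ↔ x.ofLp ⬝ᵥ l = 0 := by
  refine ⟨fun h => h _ (Submodule.mem_span_singleton_self _), fun h y hy => ?_⟩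
  obtain ⟨c, rfl⟩ := mem_line.mp hy
  simp [bil_eq, h]

theorem mem_midSpace_line {l : Fin 7 → ℂ} {x : C7} :
    x ∈ midSpace (line l) ↔ x.ofLp ⬝ᵥ l = 0 ∧ x.ofLp ⬝ᵥ star l = 0 := by
  rw [← mem_bilPerp_line, ← mem_bilPerp_line, ← conjSub_line]
  refine ⟨fun h => ⟨fun y hy => h y (Submodule.mem_sup_left hy),
    fun y hy => h y (Submodule.mem_sup_right hy)⟩, fun ⟨h1, h2⟩ y hy => ?_⟩
  obtain ⟨a, ha, b, hb, rfl⟩ := Submodule.mem_sup.mp hy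
  rw [bil_eq, WithLp.ofLp_add, dotProduct_add, ← bil_eq, ← bil_eq, h1 a ha, h2 b hb, add_zero]

theorem projMat_mulVec (W : Submodule ℂ C7) (x : Fin 7 → ℂ) :
    projMat W *ᵥ x = (W.starProjection (WithLp.toLp 2 x)).ofLp :=
  congrArg WithLp.ofLp
    (LinearMap.congr_fun (Matrix.toEuclideanLin.apply_symm_apply _) (WithLp.toLp 2 x))

theorem projMat_eq {W : Submodule ℂ C7} {A : Mat7} (hA : ∀ x, WithLp.toLp 2 (A *ᵥ x) ∈ W)
    (h : ∀ x, ∀ y ∈ W, (x - A *ᵥ x) ⬝ᵥ star y.ofLp = 0) : projMat W = A := by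
  refine ext_of_mulVec_single fun i => ?_
  rw [projMat_mulVec, Submodule.eq_starProjection_of_mem_of_inner_eq_zero (hA _)]
  intro y hy
  rw [← inner_conj_symm, EuclideanSpace.inner_eq_star_dotProduct]
  simp only [WithLp.ofLp_sub, h (Pi.single i 1) y hy, map_zero]

theorem projMat_line {l : Fin 7 → ℂ} (hl : l ≠ 0) :
    projMat (line l) = nullProj l (star l) := by
  have hn := dotProduct_star_self_ne_zero hl
  refine projMat_eq (fun x => mem_line.mpr ⟨_, by rw [nullProj_mulVec]⟩) fun x y hy => ?_
  obtain ⟨c, rfl⟩ := mem_line.mp hy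
  simp only [nullProj_mulVec, dotProduct_comm (star l) x, star_smul, dotProduct_smul,
    sub_dotProduct, smul_dotProduct, smul_eq_mul, div_mul_cancel₀ _ hn, sub_self, mul_zero]

theorem projMat_midSpace_line {l : Fin 7 → ℂ} (hl : l ≠ 0) (h0 : l ⬝ᵥ l = 0) :
    projMat (midSpace (line l)) = midProj l (star l) := by
  have hn := dotProduct_star_self_ne_zero hl
  have hn' : star l ⬝ᵥ l ≠ 0 := by rwa [dotProduct_comm]
  refine projMat_eq (fun x => mem_midSpace_line.mpr ⟨?_, ?_⟩) fun x y hy => ?_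
  · rw [dotProduct_comm, dotProduct_midProj_mulVec h0 hn]
  · rw [dotProduct_comm, ← midProj_comm,
      dotProduct_midProj_mulVec (star_dotProduct_star_eq_zero h0) hn']
  · rw [mem_midSpace_line] at hy
    have e1 := star_dotProduct_star_eq_zero hy.1
    have e2 := star_dotProduct_star_eq_zero hy.2
    rw [star_star] at e2
    rw [midProj_mulVec, dotProduct_comm]
    simp [dotProduct_sub, e1, e2]

/-- A constant vector of rational functions. -/
noncomputable def constVec (l : Fin 7 → ℂ) : Fin 7 → RatFunc ℂ := RatFunc.C ∘ l

theorem constVec_dotProduct (x y : Fin 7 → ℂ) :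
    constVec x ⬝ᵥ constVec y = RatFunc.C (x ⬝ᵥ y) :=
  (RatFunc.C.map_dotProduct x y).symm

theorem simpleElt_line (α : ℂ) {l : Fin 7 → ℂ} (hl : l ≠ 0) (h0 : l ⬝ᵥ l = 0) :
    simpleElt α (line l) = simpleMat (moeb α) (constVec l) (constVec (star l)) := by
  rw [simpleElt, conjSub_line, projMat_line hl, projMat_line (star_ne_zero.mpr hl), star_star,
    projMat_midSpace_line hl h0, constMat, constMat, constMat, map_nullProj, map_nullProj,
    map_midProj]
  rfl

/-! ### The pair condition in coordinates -/

section MidPart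

variable {n : Type*} [Fintype n] {l k : n → ℂ}

theorem dotProduct_star_eq_zero_comm (h : k ⬝ᵥ star l = 0) : l ⬝ᵥ star k = 0 := by
  simpa [dotProduct_comm] using star_dotProduct_star_eq_zero h

variable [DecidableEq n]

/-- The component of `k` in `(L ⊕ L̄)^⊥`, where `L` is the line of the null vector `l`. -/
noncomputable def midPart (l k : n → ℂ) : n → ℂ := midProj l (star l) *ᵥ k

theorem midPart_of_perp (h : k ⬝ᵥ star l = 0) :
    midPart l k = k - ((l ⬝ᵥ k) / (l ⬝ᵥ star l)) • star l := by
  rw [midPart, midProj_mulVec, dotProduct_comm (star l), h, zero_div, zero_smul, sub_zero]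

theorem midPart_star (l k : n → ℂ) : midPart l (star k) = star (midPart l k) := by
  have := map_comp_mulVec (starRingEnd ℂ) (midProj l (star l)) k
  rw [map_midProj, show starRingEnd ℂ ∘ star l = l from star_star l] at this
  rw [midPart, ← midProj_comm]
  exact this.symm

theorem dotProduct_midPart (hl : l ≠ 0) (h0 : l ⬝ᵥ l = 0) (k : n → ℂ) : l ⬝ᵥ midPart l k = 0 :=
  dotProduct_midProj_mulVec h0 (dotProduct_star_self_ne_zero hl) k

theorem star_dotProduct_midPart (hl : l ≠ 0) (h0 : l ⬝ᵥ l = 0) (k : n → ℂ) :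
    star l ⬝ᵥ midPart l k = 0 := by
  have := star_dotProduct_star_eq_zero (dotProduct_midPart hl h0 (star k))
  rwa [midPart_star, star_star] at this

theorem midPart_dotProduct_self (h0 : l ⬝ᵥ l = 0) (hk : k ⬝ᵥ k = 0) (h : k ⬝ᵥ star l = 0) :
    midPart l k ⬝ᵥ midPart l k = 0 := by
  simp [midPart_of_perp h, h, hk, star_dotProduct_star_eq_zero h0, dotProduct_comm (star l) k]

theorem smul_midPart_swap (h0 : l ⬝ᵥ l = 0) (h : k ⬝ᵥ star l = 0) :
    (k ⬝ᵥ star k) • midPart k l =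
      (midPart l k ⬝ᵥ star (midPart l k)) • l - (l ⬝ᵥ k) • star (midPart l k) := by
  obtain rfl | hl := eq_or_ne l 0
  · simp [midPart]
  obtain rfl | hk := eq_or_ne k 0
  · simp [midPart]
  rw [← midPart_star]
  exact smul_midProj_mulVec_swap h0 (star_dotProduct_star_eq_zero h0) h
    (dotProduct_star_eq_zero_comm h) (dotProduct_star_self_ne_zero hl)
    (dotProduct_star_self_ne_zero hk)

end MidPart

/-- The `𝔾₂` pair condition for the lines of `l` and `k`. -/
structure IsG2VecPair (l k : Fin 7 → ℂ) : Prop where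
  left_ne_zero : l ≠ 0
  left_null : l ⬝ᵥ l = 0
  right_null : k ⬝ᵥ k = 0
  perp : k ⬝ᵥ star l = 0
  midPart_ne_zero : midPart l k ≠ 0
  octCross_midPart : octCross l (midPart l k) = 0

theorem isComplexCoassociative_span_pair_iff {l w : Fin 7 → ℂ} :
    IsComplexCoassociative (Submodule.span ℂ {WithLp.toLp 2 l, WithLp.toLp 2 w}) ↔
      LinearIndependent ℂ ![l, w] ∧ IsNullPair l w := by
  have finrank_iff : Module.finrank ℂ (Submodule.span ℂ {WithLp.toLp 2 l, WithLp.toLp 2 w} :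
      Submodule ℂ C7) = 2 ↔ LinearIndependent ℂ ![l, w] := by
    rw [← (WithLp.linearEquiv 2 ℂ (Fin 7 → ℂ)).symm.toLinearMap.linearIndependent_iff
      (LinearEquiv.ker _), linearIndependent_iff_card_eq_finrank_span, Set.finrank, Set.range_comp]
    rw [Matrix.range_cons_cons_empty, Set.image_pair, Fintype.card_fin, eq_comm]
    rfl
  have hl : WithLp.toLp 2 l ∈ Submodule.span ℂ {WithLp.toLp 2 l, WithLp.toLp 2 w} :=
    Submodule.subset_span (by simp)
  have hw : WithLp.toLp 2 w ∈ Submodule.span ℂ {WithLp.toLp 2 l, WithLp.toLp 2 w} :=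
    Submodule.subset_span (by simp)
  refine and_congr finrank_iff ⟨fun ⟨iso, mul⟩ => ⟨iso _ hl _ hl, iso _ hl _ hw, iso _ hw _ hw, ?_⟩,
    fun h => ⟨fun x hx y hy => ?_, fun x hx y hy => ?_⟩⟩
  · exact congrArg WithLp.ofLp ((octProd_eq _ _).symm.trans (mul _ hl _ hw))
  all_goals
    obtain ⟨a, b, rfl⟩ := Submodule.mem_span_pair.mp hx
    obtain ⟨c, d, rfl⟩ := Submodule.mem_span_pair.mp hy
  · simp [bil_eq, h.left_null, h.orth, h.symm.orth, h.right_null]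
  · simp [octProd_eq, octCross_self, h.octCross_eq_zero, h.symm.octCross_eq_zero]

theorem linearIndependent_pair_midPart_iff {l k : Fin 7 → ℂ} (hl : l ≠ 0) (h0 : l ⬝ᵥ l = 0) :
    LinearIndependent ℂ ![l, midPart l k] ↔ midPart l k ≠ 0 := by
  refine ⟨fun h => h.ne_zero 1, fun hw => ?_⟩
  rw [LinearIndependent.pair_iff' hl]
  intro a ha
  have := congrArg (star l ⬝ᵥ ·) ha
  simp only [star_dotProduct_midPart hl h0, dotProduct_smul, smul_eq_mul, mul_eq_zero] at this
  rw [dotProduct_comm, or_iff_left (dotProduct_star_self_ne_zero hl)] at this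
  exact hw (by rw [← ha, this, zero_smul])

theorem line_sup_map_starProjection {l : Fin 7 → ℂ} (hl : l ≠ 0) (h0 : l ⬝ᵥ l = 0)
    (k : Fin 7 → ℂ) :
    line l ⊔ (line k).map ((midSpace (line l)).starProjection : C7 →ₗ[ℂ] C7) =
      Submodule.span ℂ {WithLp.toLp 2 l, WithLp.toLp 2 (midPart l k)} := by
  have proj := projMat_mulVec (midSpace (line l)) k
  rw [projMat_midSpace_line hl h0] at proj
  rw [map_line, ContinuousLinearMap.coe_coe, ← proj, line, line, ← Submodule.span_union,
    Set.singleton_union, midPart]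

theorem isG2Pair_line_iff {l k : Fin 7 → ℂ} (hl : l ≠ 0) (hk : k ≠ 0) (h0 : l ⬝ᵥ l = 0)
    (k0 : k ⬝ᵥ k = 0) : IsG2Pair (line l) (line k) ↔ IsG2VecPair l k := by
  have perp_iff : line k ≤ bilPerp (conjSub (line l)) ↔ k ⬝ᵥ star l = 0 := by
    rw [conjSub_line, line_le_iff, mem_bilPerp_line]
  have coassoc_iff := isComplexCoassociative_span_pair_iff (l := l) (w := midPart l k)
  rw [← line_sup_map_starProjection hl h0, linearIndependent_pair_midPart_iff hl h0] at coassoc_iff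
  constructor
  · intro h
    obtain ⟨mid_ne, null⟩ := coassoc_iff.mp h.coassoc
    exact ⟨hl, h0, k0, perp_iff.mp h.perp, mid_ne, null.octCross_eq_zero⟩
  · intro h
    exact ⟨isIsotropicLine_line hl h0, isIsotropicLine_line hk k0, perp_iff.mpr h.perp,
      coassoc_iff.mpr ⟨h.midPart_ne_zero, h0, dotProduct_midPart hl h0 k,
        midPart_dotProduct_self h0 k0 h.perp, h.octCross_midPart⟩⟩

theorem IsNullPair.star {l w : Fin 7 → ℂ} (h : IsNullPair l w) :
    IsNullPair (star l) (star w) where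
  left_null := star_dotProduct_star_eq_zero h.left_null
  orth := star_dotProduct_star_eq_zero h.orth
  right_null := star_dotProduct_star_eq_zero h.right_null
  octCross_eq_zero := by
    have := map_comp_octCross (starRingEnd ℂ) l w
    rw [h.octCross_eq_zero] at this
    refine this.symm.trans ?_
    ext; simp

namespace IsG2VecPair

variable {l k : Fin 7 → ℂ}

theorem right_ne_zero (h : IsG2VecPair l k) : k ≠ 0 := by
  rintro rfl
  exact h.midPart_ne_zero (mulVec_zero _)

theorem isNullPair (h : IsG2VecPair l k) : IsNullPair l (midPart l k) :=
  ⟨h.left_null, dotProduct_midPart h.left_ne_zero h.left_null k,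
    midPart_dotProduct_self h.left_null h.right_null h.perp, h.octCross_midPart⟩

theorem symm (h : IsG2VecPair l k) : IsG2VecPair k l := by
  have hl := dotProduct_star_self_ne_zero h.left_ne_zero
  have hk := dotProduct_star_self_ne_zero h.right_ne_zero
  have hw := dotProduct_star_self_ne_zero h.midPart_ne_zero
  have swap := smul_midPart_swap h.left_null h.perp
  have h_star := h.isNullPair.star
  have l_orth : l ⬝ᵥ star (midPart l k) = 0 :=
    midPart_star l k ▸ dotProduct_midPart h.left_ne_zero h.left_null (star k)
  have star_orth := star_dotProduct_midPart h.left_ne_zero h.left_null k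
  refine ⟨h.right_ne_zero, h.right_null, h.left_null, dotProduct_star_eq_zero_comm h.perp,
    fun mid_eq => ?_, ?_⟩
  · have := congrArg (star l ⬝ᵥ ·) swap
    simp only [mid_eq, smul_zero, dotProduct_zero, dotProduct_sub, dotProduct_smul, h_star.orth,
      smul_eq_mul, mul_zero, sub_zero] at this
    exact mul_ne_zero hw (dotProduct_comm l _ ▸ hl) this.symm
  · have key := h.isNullPair.smul_octCross_eq (IsUnit.mk0 2 two_ne_zero) h_star l_orth
      (by rw [dotProduct_comm, star_orth])
    have octCross_k (y) : octCross k y =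
        octCross (midPart l k) y + ((l ⬝ᵥ k) / (l ⬝ᵥ star l)) • octCross (star l) y := by
      rw [← LinearMap.smul_apply, ← LinearMap.add_apply, ← map_smul, ← map_add,
        midPart_of_perp h.perp, sub_add_cancel]
    refine smul_right_injective _ hk ?_
    simp only [smul_zero]
    rw [← map_smul, swap, map_sub, map_smul, map_smul, octCross_k, octCross_k,
      h.isNullPair.symm.octCross_eq_zero, h_star.octCross_eq_zero, ← octCross_anticomm l,
      ← octCross_anticomm (star (midPart l k))]
    linear_combination (norm := skip) (-((l ⬝ᵥ k) / (l ⬝ᵥ star l))) • key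
    match_scalars <;> field_simp <;> ring

end IsG2VecPair

/-! ### The Möbius factor -/

section Moebius

variable {α : ℂ}

theorem moeb_ne_zero (α : ℂ) : moeb α ≠ 0 := div_ne_zero (X_sub_C_ne_zero _) (X_sub_C_ne_zero _)

theorem inv_moeb (α : ℂ) : (moeb α)⁻¹ = moeb (starRingEnd ℂ α) := by
  rw [moeb, moeb, inv_div, Complex.conj_conj]

theorem ratConj_moeb (α : ℂ) : ratConj (moeb α) = (moeb α)⁻¹ := by
  rw [inv_moeb, moeb, moeb, map_div₀, ratConj_X_sub_C, ratConj_X_sub_C]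

theorem moeb_mem_regularSubring {z : ℂ} (hz : z ≠ starRingEnd ℂ α) :
    moeb α ∈ regularSubring z := by
  rw [moeb, div_eq_mul_inv]
  refine mul_mem (X_sub_C_mem_regularSubring z α) (inv_mem_regularSubring ?_)
  rwa [eval_X_sub_C, sub_ne_zero]

theorem eval_moeb {z : ℂ} (hz : z ≠ starRingEnd ℂ α) :
    (moeb α).eval (RingHom.id ℂ) z = (z - α) / (z - starRingEnd ℂ α) := by
  rw [moeb, eval_div_of_mem (X_sub_C_mem_regularSubring _ _) (moeb_mem_regularSubring hz)
    (by rwa [eval_X_sub_C, sub_ne_zero]), eval_X_sub_C, eval_X_sub_C]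

theorem tendsto_eval_moeb (α : ℂ) :
    Tendsto (fun z => (moeb α).eval (RingHom.id ℂ) z) (Bornology.cobounded ℂ) (nhds 1) := by
  have inv_tendsto : Tendsto (fun z => (z - starRingEnd ℂ α)⁻¹) (Bornology.cobounded ℂ) (nhds 0) :=
    tendsto_inv₀_cobounded.comp (tendsto_sub_const_cobounded _)
  have : Tendsto (fun z => 1 + (starRingEnd ℂ α - α) * (z - starRingEnd ℂ α)⁻¹)
      (Bornology.cobounded ℂ) (nhds 1) := by
    simpa using (inv_tendsto.const_mul (starRingEnd ℂ α - α)).const_add 1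
  refine this.congr' ?_
  filter_upwards [Bornology.eventually_ne_cobounded (starRingEnd ℂ α)] with z hz
  have := sub_ne_zero.mpr hz
  rw [eval_moeb hz]
  field_simp
  ring

theorem ne_conj_of_im_ne_zero (hα : α.im ≠ 0) : α ≠ starRingEnd ℂ α := fun h =>
  hα (Complex.conj_eq_iff_im.mp h.symm)

theorem eval_moeb_self (hα : α.im ≠ 0) : (moeb α).eval (RingHom.id ℂ) α = 0 := by
  rw [eval_moeb (ne_conj_of_im_ne_zero hα), sub_self, zero_div]

theorem X_sub_C_eq_mul_moeb (α : ℂ) : (RatFunc.X - RatFunc.C α : RatFunc ℂ) =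
    (RatFunc.X - RatFunc.C (starRingEnd ℂ α)) * moeb α := by
  rw [moeb, mul_div_cancel₀ _ (X_sub_C_ne_zero _)]

theorem inv_moeb_mul_mem_regularSubring {f : RatFunc ℂ} (hf : f ∈ regularSubring α)
    (h0 : f.eval (RingHom.id ℂ) α = 0) : (moeb α)⁻¹ * f ∈ regularSubring α := by
  obtain ⟨g, hg, rfl⟩ := exists_eq_mul_of_eval_eq_zero hf h0
  rw [X_sub_C_eq_mul_moeb, mul_right_comm, mul_comm _ (moeb α),
    inv_mul_cancel_left₀ (moeb_ne_zero α)]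
  exact mul_mem (X_sub_C_mem_regularSubring _ _) hg

theorem RegularAt.inv_moeb_smul {g : RatMat} (hg : RegularAt g α) (h0 : value g α = 0) :
    RegularAt ((moeb α)⁻¹ • g) α := fun i j =>
  inv_moeb_mul_mem_regularSubring (hg i j) (congrFun₂ h0 i j)

end Moebius

/-! ### Simple elements -/

/-- The simple element `p_{α,L}` of the line `L` spanned by the null vector `l`. -/
noncomputable def simpleLoop (α : ℂ) (l : Fin 7 → ℂ) : RatMat :=
  simpleMat (moeb α) (constVec l) (constVec (star l))

section SimpleLoop

variable {α : ℂ} {l : Fin 7 → ℂ}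

theorem simpleLoop_eq (α : ℂ) (l : Fin 7 → ℂ) :
    simpleLoop α l = (moeb α)⁻¹ • constMat (nullProj (star l) l) +
      constMat (midProj l (star l)) + moeb α • constMat (nullProj l (star l)) := by
  simp only [constMat, map_nullProj, map_midProj]
  rfl

theorem simpleLoop_mem_orthogonalGroup (α : ℂ) (hl : l ≠ 0) (h0 : l ⬝ᵥ l = 0) :
    simpleLoop α l ∈ orthogonalGroup (Fin 7) (RatFunc ℂ) := by
  refine simpleMat_mem_orthogonalGroup (moeb_ne_zero α) ?_ ?_ ?_ <;> rw [constVec_dotProduct]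
  · rw [h0, map_zero]
  · rw [star_dotProduct_star_eq_zero h0, map_zero]
  · exact (map_ne_zero _).mpr (dotProduct_star_self_ne_zero hl)

theorem ratConj_comp_constVec (l : Fin 7 → ℂ) : ratConj ∘ constVec l = constVec (star l) :=
  funext fun i => ratConj_C (l i)

theorem simpleLoop_map_ratConj (α : ℂ) (l : Fin 7 → ℂ) :
    (simpleLoop α l).map ratConj = simpleLoop α l := by
  rw [simpleLoop, map_simpleMat, ratConj_moeb, ratConj_comp_constVec, ratConj_comp_constVec,
    star_star, simpleMat_inv]

theorem tendsto_value_simpleLoop (α : ℂ) (l : Fin 7 → ℂ) :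
    Tendsto (value (simpleLoop α l)) (Bornology.cobounded ℂ) (nhds 1) := by
  have limit := (((tendsto_eval_moeb (starRingEnd ℂ α)).smul_const (nullProj (star l) l)).add
    (tendsto_const_nhds (x := midProj l (star l)))).add
    ((tendsto_eval_moeb α).smul_const (nullProj l (star l)))
  have sum_eq : nullProj (star l) l + midProj l (star l) + nullProj l (star l) = 1 := by
    rw [midProj]; abel
  rw [one_smul, one_smul, sum_eq] at limit
  refine limit.congr' ?_
  filter_upwards [Bornology.eventually_ne_cobounded α,
    Bornology.eventually_ne_cobounded (starRingEnd ℂ α)] with z hz hz'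
  have mem := moeb_mem_regularSubring hz'
  have mem_inv := moeb_mem_regularSubring (α := starRingEnd ℂ α) (by rwa [Complex.conj_conj])
  have reg (A : Mat7) := regularAt_constMat A z
  rw [simpleLoop_eq, inv_moeb, value_add (((reg _).smul mem_inv).add (reg _)) ((reg _).smul mem),
    value_add ((reg _).smul mem_inv) (reg _), value_smul mem_inv (reg _), value_smul mem (reg _),
    value_constMat, value_constMat, value_constMat]

/-- The part of the simple element that is regular at `α`. -/
noncomputable def regularPart (α : ℂ) (l : Fin 7 → ℂ) : RatMat :=
  constMat (midProj l (star l)) + moeb α • constMat (nullProj l (star l))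

theorem simpleLoop_eq_add_regularPart (α : ℂ) (l : Fin 7 → ℂ) :
    simpleLoop α l = (moeb α)⁻¹ • constMat (nullProj (star l) l) + regularPart α l := by
  rw [simpleLoop_eq, regularPart, add_assoc]

theorem regularAt_regularPart (hα : α.im ≠ 0) (l : Fin 7 → ℂ) : RegularAt (regularPart α l) α :=
  (regularAt_constMat _ _).add
    ((regularAt_constMat _ _).smul (moeb_mem_regularSubring (ne_conj_of_im_ne_zero hα)))

theorem value_regularPart (hα : α.im ≠ 0) (l : Fin 7 → ℂ) :
    value (regularPart α l) α = midProj l (star l) := by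
  have moeb_mem := moeb_mem_regularSubring (ne_conj_of_im_ne_zero hα)
  rw [regularPart, value_add (regularAt_constMat _ _) ((regularAt_constMat _ _).smul moeb_mem),
    value_smul moeb_mem (regularAt_constMat _ _), eval_moeb_self hα, zero_smul, add_zero,
    value_constMat]

end SimpleLoop

/-! ### Dressing -/

section Dressing

variable {α : ℂ} {h : RatMat} {k v : Fin 7 → ℂ}

theorem constMat_transpose (A : Mat7) : (constMat A)ᵀ = constMat Aᵀ := rfl

theorem constMat_vecMulVec_mul_mul (a k v b : Fin 7 → ℂ) (h : RatMat) :
    constMat (vecMulVec a k) * h * constMat (vecMulVec v b) =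
      (constVec k ⬝ᵥ h *ᵥ constVec v) • constMat (vecMulVec a b) := by
  have eq (x y) : constMat (vecMulVec x y) = vecMulVec (constVec x) (constVec y) := by
    ext; simp [constMat, constVec, vecMulVec_apply]
  rw [eq, eq, eq, vecMulVec_mul, vecMulVec_mul_vecMulVec, dotProduct_mulVec, vecMulVec_smul]

theorem RegularAt.exists_lift_mulVec_constVec (hr : RegularAt h α) (v : Fin 7 → ℂ) :
    ∃ d : Fin 7 → regularSubring α,
      (regularSubring α).subtype ∘ d = h *ᵥ constVec v ∧ evalRegular α ∘ d = value h α *ᵥ v := by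
  obtain ⟨H, rfl, hH⟩ := hr.exists_lift
  refine ⟨H *ᵥ fun j => ⟨RatFunc.C (v j), C_mem_regularSubring α (v j)⟩, map_comp_mulVec _ _ _, ?_⟩
  rw [map_comp_mulVec, hH]
  exact congrArg (_ *ᵥ ·) (funext fun j => RatFunc.eval_C ..)

/-- As `h` is orthogonal, `h v - k` pairs with itself to `-2⟨k, h v⟩`, so the first order zero of
`h v - k` at `α` makes `⟨k, h v⟩` vanish to second order. -/
theorem inv_moeb_sq_mul_dotProduct_mem_regularSubring
    (ho : h ∈ orthogonalGroup (Fin 7) (RatFunc ℂ)) (hr : RegularAt h α) (k0 : k ⬝ᵥ k = 0)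
    (v0 : v ⬝ᵥ v = 0) (hv : value h α *ᵥ v = k) :
    (moeb α)⁻¹ ^ 2 * (constVec k ⬝ᵥ h *ᵥ constVec v) ∈ regularSubring α := by
  set d := h *ᵥ constVec v - constVec k with hd
  have d_mem (i) : (moeb α)⁻¹ * d i ∈ regularSubring α := by
    obtain ⟨w, hw, eval_w⟩ := hr.exists_lift_mulVec_constVec v
    have mem_C : constVec k i ∈ regularSubring α := C_mem_regularSubring α (k i)
    rw [hd, ← hw]
    refine inv_moeb_mul_mem_regularSubring (sub_mem (w i).2 mem_C) ?_
    refine ((evalRegular α).map_sub (w i) ⟨_, mem_C⟩).trans (sub_eq_zero.mpr ?_)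
    exact (congrFun (eval_w.trans hv) i).trans (RatFunc.eval_C (RingHom.id ℂ) α (c := k i)).symm
  have polarization : constVec k ⬝ᵥ h *ᵥ constVec v = RatFunc.C (-2⁻¹) * (d ⬝ᵥ d) := by
    have c2 : (RatFunc.C (-2⁻¹) : RatFunc ℂ) * 2 = -1 := by
      rw [← map_ofNat RatFunc.C 2, ← map_mul]
      norm_num
    have : d ⬝ᵥ d = -2 * (constVec k ⬝ᵥ h *ᵥ constVec v) := by
      rw [hd, sub_dotProduct, dotProduct_sub, dotProduct_sub,
        dotProduct_mulVec_mulVec_of_mem_orthogonalGroup ho, constVec_dotProduct,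
        constVec_dotProduct, v0, k0, dotProduct_comm _ (constVec k), map_zero]
      ring
    rw [this]
    linear_combination (constVec k ⬝ᵥ h *ᵥ constVec v) * c2
  rw [polarization, dotProduct, Finset.mul_sum, Finset.mul_sum]
  refine sum_mem fun i _ => ?_
  convert mul_mem (C_mem_regularSubring α (-2⁻¹)) (mul_mem (d_mem i) (d_mem i)) using 1
  ring

theorem regularAt_inv_moeb_smul_regularPart_mul_mul (hα : α.im ≠ 0) (hr : RegularAt h α)
    (hk : k ≠ 0) (k0 : k ⬝ᵥ k = 0) (hv : value h α *ᵥ v = k) :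
    RegularAt ((moeb α)⁻¹ • (regularPart α k * h * constMat (nullProj v (star v)))) α := by
  have reg := (regularAt_regularPart hα k).mul hr
  have reg_const := regularAt_constMat (nullProj v (star v)) α
  refine (reg.mul reg_const).inv_moeb_smul ?_
  rw [value_mul reg reg_const, value_mul (regularAt_regularPart hα k) hr, value_constMat,
    value_regularPart hα, nullProj, Matrix.mul_smul, mul_vecMulVec, ← mulVec_mulVec, hv,
    midProj_mulVec_left k0 (dotProduct_star_self_ne_zero hk), zero_vecMulVec, smul_zero]

theorem regularAt_simpleLoop_mul_mul_transpose (hα : α.im ≠ 0)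
    (ho : h ∈ orthogonalGroup (Fin 7) (RatFunc ℂ)) (hr : RegularAt h α) (hk : k ≠ 0)
    (k0 : k ⬝ᵥ k = 0) (v0 : v ⬝ᵥ v = 0) (hv : value h α *ᵥ v = k) :
    RegularAt (simpleLoop α k * h * (simpleLoop α v)ᵀ) α := by
  have v_ne : v ≠ 0 := fun v_eq => hk (by rw [← hv, v_eq, mulVec_zero])
  have hv_symm : value hᵀ α *ᵥ k = v := by
    rw [value_transpose, ← hv, mulVec_mulVec,
      (mem_orthogonalGroup_iff' _ _).mp (value_mem_orthogonalGroup ho hr), one_mulVec]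
  set E := constMat (nullProj (star k) k) with hE
  set A := regularPart α k
  set E' := constMat (nullProj v (star v)) with hE'
  set B := (regularPart α v)ᵀ with hB
  have expand : simpleLoop α k * h * (simpleLoop α v)ᵀ =
      (moeb α)⁻¹ ^ 2 • (E * h * E') + (moeb α)⁻¹ • (E * h * B) + (moeb α)⁻¹ • (A * h * E') +
        A * h * B := by
    rw [simpleLoop_eq_add_regularPart, simpleLoop_eq_add_regularPart, transpose_add,
      transpose_smul, constMat_transpose, transpose_nullProj]
    simp only [Matrix.add_mul, Matrix.mul_add, Matrix.smul_mul, Matrix.mul_smul,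
      smul_add, smul_smul, ← sq]
    abel
  have double_pole : RegularAt ((moeb α)⁻¹ ^ 2 • (E * h * E')) α := by
    rw [hE, hE', nullProj, nullProj, ← smul_vecMulVec, ← vecMulVec_smul,
      constMat_vecMulVec_mul_mul, smul_smul]
    exact (regularAt_constMat _ _).smul
      (inv_moeb_sq_mul_dotProduct_mem_regularSubring ho hr k0 v0 hv)
  have left_pole : RegularAt ((moeb α)⁻¹ • (E * h * B)) α := by
    have := (regularAt_inv_moeb_smul_regularPart_mul_mul hα hr.transpose v_ne v0 hv_symm).transpose
    rwa [transpose_smul, transpose_mul, transpose_mul, transpose_transpose, constMat_transpose,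
      transpose_nullProj, ← Matrix.mul_assoc, ← hE, ← hB] at this
  have right_pole := regularAt_inv_moeb_smul_regularPart_mul_mul hα hr hk k0 hv
  rw [expand]
  exact ((double_pole.add left_pole).add right_pole).add
    (((regularAt_regularPart hα k).mul hr).mul (regularAt_regularPart hα v).transpose)

end Dressing

/-! ### The pole of a pair -/

section PairPole

variable {α : ℂ} {l k : Fin 7 → ℂ}

/-- The coefficient of `(λ - ᾱ) / (λ - α)` in the product of the simple elements of `l` and `k`; it
plays the role of the residue at `α` when `⟨k, l̄⟩ = 0`. -/
noncomputable def pairResidue (l k : Fin 7 → ℂ) : Mat7 :=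
  nullProj (star l) l * midProj k (star k) + midProj l (star l) * nullProj (star k) k

theorem transpose_pairResidue_mulVec (l k y : Fin 7 → ℂ) :
    (pairResidue l k)ᵀ *ᵥ y = ((star l ⬝ᵥ y) / (l ⬝ᵥ star l)) • midPart k l +
      ((star k ⬝ᵥ midPart l y) / (k ⬝ᵥ star k)) • k := by
  rw [pairResidue, transpose_add, transpose_mul, transpose_mul, transpose_midProj,
    transpose_midProj, transpose_nullProj, transpose_nullProj, add_mulVec, ← mulVec_mulVec,
    ← mulVec_mulVec, nullProj_mulVec, nullProj_mulVec, mulVec_smul]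
  rfl

theorem transpose_pairResidue_mulVec_left (hl : l ≠ 0) (l0 : l ⬝ᵥ l = 0) (k : Fin 7 → ℂ) :
    (pairResidue l k)ᵀ *ᵥ l = midPart k l := by
  have hn := dotProduct_star_self_ne_zero hl
  have mid_eq : midPart l l = 0 := midProj_mulVec_left l0 hn
  rw [transpose_pairResidue_mulVec, mid_eq, dotProduct_zero, zero_div, zero_smul, add_zero,
    dotProduct_comm (star l), div_self hn, one_smul]

theorem nullProj_mul_nullProj_eq_zero_iff {n : Type*} [Fintype n] {l k : n → ℂ} (hl : l ≠ 0)
    (hk : k ≠ 0) :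
    nullProj (star l) l * nullProj (star k) k = 0 ↔ l ⬝ᵥ star k = 0 := by
  have hl' := dotProduct_star_self_ne_zero hl
  have hk' := dotProduct_star_self_ne_zero hk
  rw [nullProj_mul_nullProj, smul_eq_zero, vecMulVec_eq_zero, mul_eq_zero, mul_eq_zero,
    inv_eq_zero, inv_eq_zero, dotProduct_comm (star l), dotProduct_comm (star k)]
  simp [hl, hk, hl', hk']

theorem exists_regularAt_moeb_smul_simpleLoop_mul_eq (hα : α.im ≠ 0) (l k : Fin 7 → ℂ) :
    ∃ g, RegularAt g α ∧ value g α = pairResidue l k ∧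
      moeb α • (simpleLoop α l * simpleLoop α k) =
        (moeb α)⁻¹ • constMat (nullProj (star l) l * nullProj (star k) k) + g := by
  have reg := regularAt_regularPart hα
  have moeb_mem := moeb_mem_regularSubring (ne_conj_of_im_ne_zero hα)
  have constMat_mul : constMat (nullProj (star l) l * nullProj (star k) k) =
      constMat (nullProj (star l) l) * constMat (nullProj (star k) k) := Matrix.map_mul
  have reg_l : RegularAt (constMat (nullProj (star l) l)) α := regularAt_constMat _ α
  have reg_k : RegularAt (constMat (nullProj (star k) k)) α := regularAt_constMat _ α
  have left := reg_l.mul (reg k)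
  have right := (reg l).mul reg_k
  have prod := (reg l).mul (reg k)
  refine ⟨_, (left.add right).add (prod.smul moeb_mem), ?_, ?_⟩
  · rw [value_add (left.add right) (prod.smul moeb_mem), value_add left right,
      value_mul reg_l (reg k), value_mul (reg l) reg_k, value_smul moeb_mem prod,
      eval_moeb_self hα, zero_smul, add_zero, value_constMat, value_constMat,
      value_regularPart hα, value_regularPart hα, pairResidue]
  · rw [simpleLoop_eq_add_regularPart, simpleLoop_eq_add_regularPart, constMat_mul]
    simp only [Matrix.add_mul, Matrix.mul_add, Matrix.smul_mul, Matrix.mul_smul, smul_add,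
      smul_inv_smul₀ (moeb_ne_zero α)]
    abel

theorem value_eq_zero_of_regularAt_inv_moeb_smul (hα : α.im ≠ 0) {g : RatMat}
    (h : RegularAt ((moeb α)⁻¹ • g) α) : value g α = 0 := by
  have := value_smul (moeb_mem_regularSubring (ne_conj_of_im_ne_zero hα)) h
  rwa [smul_inv_smul₀ (moeb_ne_zero α), eval_moeb_self hα, zero_smul] at this

theorem regularAt_moeb_smul_simpleLoop_mul_iff (hα : α.im ≠ 0) (hl : l ≠ 0) (hk : k ≠ 0) :
    RegularAt (moeb α • (simpleLoop α l * simpleLoop α k)) α ↔ k ⬝ᵥ star l = 0 := by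
  obtain ⟨g, reg_g, -, eq⟩ := exists_regularAt_moeb_smul_simpleLoop_mul_eq hα l k
  constructor
  · intro h
    have reg : RegularAt ((moeb α)⁻¹ • constMat (nullProj (star l) l * nullProj (star k) k)) α :=
      eq_sub_of_add_eq eq.symm ▸ (regularSubring α).matrix.sub_mem h reg_g
    have := value_eq_zero_of_regularAt_inv_moeb_smul hα reg
    rw [value_constMat, nullProj_mul_nullProj_eq_zero_iff hl hk] at this
    exact dotProduct_star_eq_zero_comm this
  · intro h
    have mul_eq := (nullProj_mul_nullProj_eq_zero_iff hl hk).mpr (dotProduct_star_eq_zero_comm h)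
    rwa [eq, mul_eq, constMat, Matrix.map_zero _ (map_zero _), smul_zero, zero_add]

theorem value_moeb_smul_simpleLoop_mul (hα : α.im ≠ 0) (hl : l ≠ 0) (hk : k ≠ 0)
    (h : k ⬝ᵥ star l = 0) :
    value (moeb α • (simpleLoop α l * simpleLoop α k)) α = pairResidue l k := by
  obtain ⟨g, -, value_g, eq⟩ := exists_regularAt_moeb_smul_simpleLoop_mul_eq hα l k
  have mul_eq := (nullProj_mul_nullProj_eq_zero_iff hl hk).mpr (dotProduct_star_eq_zero_comm h)
  rwa [eq, mul_eq, constMat, Matrix.map_zero _ (map_zero _), smul_zero, zero_add]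

theorem IsG2VecPair.hasSimplePoleAt (hα : α.im ≠ 0) (h : IsG2VecPair l k) :
    HasSimplePoleAt (simpleLoop α l * simpleLoop α k) α := by
  have hl := h.left_ne_zero
  have hk := h.right_ne_zero
  refine ⟨fun reg => h.symm.midPart_ne_zero ?_, ?_⟩
  · have value_eq := value_smul (moeb_mem_regularSubring (ne_conj_of_im_ne_zero hα)) reg
    rw [value_moeb_smul_simpleLoop_mul hα hl hk h.perp, eval_moeb_self hα, zero_smul] at value_eq
    rw [← transpose_pairResidue_mulVec_left hl h.left_null, value_eq, transpose_zero, zero_mulVec]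
  · rw [X_sub_C_eq_mul_moeb, mul_smul]
    exact ((regularAt_moeb_smul_simpleLoop_mul_iff hα hl hk).mpr h.perp).smul
      (X_sub_C_mem_regularSubring _ _)

end PairPole

/-! ### Inheritance of the pair condition -/

section Inheritance

variable {α : ℂ} {l k l' k' : Fin 7 → ℂ}

theorem pairResidue_eq_of_mul_eq {f h : RatMat} (hα : α.im ≠ 0) (hl : l ≠ 0) (hk : k ≠ 0)
    (hl' : l' ≠ 0) (hk' : k' ≠ 0) (perp : k ⬝ᵥ star l = 0)
    (hf : f ∈ orthogonalGroup (Fin 7) (RatFunc ℂ)) (rf : RegularAt f α) (rh : RegularAt h α)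
    (eq : f * (simpleLoop α l' * simpleLoop α k') = simpleLoop α l * simpleLoop α k * h) :
    k' ⬝ᵥ star l' = 0 ∧ pairResidue l' k' = (value f α)ᵀ * pairResidue l k * value h α := by
  have smul_eq : moeb α • (simpleLoop α l' * simpleLoop α k') =
      fᵀ * (moeb α • (simpleLoop α l * simpleLoop α k)) * h := by
    rw [Matrix.mul_smul, Matrix.smul_mul, Matrix.mul_assoc, ← eq, ← Matrix.mul_assoc,
      (mem_orthogonalGroup_iff' _ _).mp hf, Matrix.one_mul]
  have reg := (regularAt_moeb_smul_simpleLoop_mul_iff hα hl hk).mpr perp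
  have perp' := (regularAt_moeb_smul_simpleLoop_mul_iff hα hl' hk').mp
    (smul_eq ▸ (rf.transpose.mul reg).mul rh)
  refine ⟨perp', ?_⟩
  rw [← value_moeb_smul_simpleLoop_mul hα hl' hk' perp', smul_eq,
    value_mul (rf.transpose.mul reg) rh, value_mul rf.transpose reg,
    value_moeb_smul_simpleLoop_mul hα hl hk perp, value_transpose]

theorem IsG2VecPair.of_pairResidue_eq {F H : Mat7} (hp : IsG2VecPair l k)
    (hF : F ∈ orthogonalGroup (Fin 7) ℂ) (hH : IsOctAut H) (hl' : l' ≠ 0) (l0' : l' ⬝ᵥ l' = 0)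
    (hk' : H *ᵥ k' = k) (perp : k' ⬝ᵥ star l' = 0)
    (eq : pairResidue l' k' = Fᵀ * pairResidue l k * H) : IsG2VecPair l' k' := by
  have H_pairResidue (y) : H *ᵥ (pairResidue l' k')ᵀ *ᵥ y = (pairResidue l k)ᵀ *ᵥ F *ᵥ y := by
    rw [eq, transpose_mul, transpose_mul, transpose_transpose, ← mulVec_mulVec, ← mulVec_mulVec,
      mulVec_mulVec _ H, (mem_orthogonalGroup_iff _ _).mp hH.mem_orthogonalGroup, one_mulVec]
  have k'_ne : k' ≠ 0 := by
    rintro rfl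
    exact hp.right_ne_zero (hk'.symm.trans (mulVec_zero H))
  have k'_null : k' ⬝ᵥ k' = 0 := by
    rw [← dotProduct_mulVec_mulVec_of_mem_orthogonalGroup hH.mem_orthogonalGroup, hk',
      hp.right_null]
  refine symm ⟨k'_ne, k'_null, l0', dotProduct_star_eq_zero_comm perp, fun mid_eq => ?_, ?_⟩
  · refine hp.symm.midPart_ne_zero ?_
    have midPart_eq : midPart k l = ((star k' ⬝ᵥ midPart l' (Fᵀ *ᵥ l)) / (k' ⬝ᵥ star k')) • k := by
      have key := H_pairResidue (Fᵀ *ᵥ l)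
      rw [mulVec_mulVec _ F, (mem_orthogonalGroup_iff _ _).mp hF, one_mulVec,
        transpose_pairResidue_mulVec_left hp.left_ne_zero hp.left_null,
        transpose_pairResidue_mulVec, mid_eq, smul_zero, zero_add, mulVec_smul, hk'] at key
      exact key.symm
    have orth := star_dotProduct_midPart hp.right_ne_zero hp.right_null l
    rw [midPart_eq, dotProduct_smul, smul_eq_mul, mul_eq_zero, dotProduct_comm (star k) k,
      or_iff_left (dotProduct_star_self_ne_zero hp.right_ne_zero)] at orth
    rw [midPart_eq, orth, zero_smul]
  · have octCross_eq : H *ᵥ octCross k' (midPart k' l') = 0 := by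
      rw [hH.mulVec_octCross, hk', ← transpose_pairResidue_mulVec_left hl' l0', H_pairResidue,
        transpose_pairResidue_mulVec, map_add, map_smul, map_smul, octCross_self,
        hp.symm.octCross_midPart, smul_zero, smul_zero, add_zero]
    rw [← one_mulVec (octCross _ _), ← (mem_orthogonalGroup_iff' _ _).mp hH.mem_orthogonalGroup,
      ← mulVec_mulVec, octCross_eq, mulVec_zero]

end Inheritance

/-! ### The pair element as a loop in `𝔾₂` -/

section PairLoop

theorem IsNullPair.constVec {l w : Fin 7 → ℂ} (h : IsNullPair l w) :
    IsNullPair (constVec l) (constVec w) where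
  left_null := by rw [constVec_dotProduct, h.left_null, map_zero]
  orth := by rw [constVec_dotProduct, h.orth, map_zero]
  right_null := by rw [constVec_dotProduct, h.right_null, map_zero]
  octCross_eq_zero := by
    rw [G2Loop.constVec, G2Loop.constVec, ← map_comp_octCross, h.octCross_eq_zero]
    exact funext fun _ => map_zero _

theorem constVec_add_smul (x y : Fin 7 → ℂ) (a : ℂ) :
    constVec (x + a • y) = constVec x + RatFunc.C a • constVec y := by
  ext i
  simp [constVec]

theorem IsG2VecPair.isNegRealOctLoop {l k : Fin 7 → ℂ} (α : ℂ) (h : IsG2VecPair l k) :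
    IsNegRealOctLoop (simpleLoop α l * simpleLoop α k) where
  isOctAut := by
    have orth := star_dotProduct_midPart h.left_ne_zero h.left_null k
    have k_eq : k = midPart l k + ((l ⬝ᵥ k) / (l ⬝ᵥ star l)) • star l := by
      rw [midPart_of_perp h.perp, sub_add_cancel]
    have star_k_eq : star k = star (midPart l k) + star ((l ⬝ᵥ k) / (l ⬝ᵥ star l)) • l := by
      conv_lhs => rw [k_eq, star_add, star_smul, star_star]
    have constVec_ne {x y : Fin 7 → ℂ} (hxy : x ⬝ᵥ y ≠ 0) :
        G2Loop.constVec x ⬝ᵥ G2Loop.constVec y ≠ 0 := by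
      rwa [constVec_dotProduct, map_ne_zero]
    have constVec_eq_zero {x y : Fin 7 → ℂ} (hxy : x ⬝ᵥ y = 0) :
        G2Loop.constVec x ⬝ᵥ G2Loop.constVec y = 0 := by
      rw [constVec_dotProduct, hxy, map_zero]
    have key := isOctAut_simpleMat_mul_simpleMat (a := RatFunc.C ((l ⬝ᵥ k) / (l ⬝ᵥ star l)))
      (a' := RatFunc.C (star ((l ⬝ᵥ k) / (l ⬝ᵥ star l)))) two_ne_zero (moeb_ne_zero α)
      h.isNullPair.constVec h.isNullPair.star.constVec
      (constVec_ne (dotProduct_star_self_ne_zero h.left_ne_zero))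
      (constVec_ne (dotProduct_star_self_ne_zero h.midPart_ne_zero))
      (constVec_eq_zero (dotProduct_star_eq_zero_comm ((dotProduct_comm _ _).trans orth)))
      (constVec_eq_zero orth)
    rw [← constVec_add_smul, ← constVec_add_smul, ← k_eq, ← star_k_eq] at key
    exact key (constVec_ne (dotProduct_star_self_ne_zero h.right_ne_zero))
  map_ratConj := by rw [Matrix.map_mul, simpleLoop_map_ratConj, simpleLoop_map_ratConj]
  tendsto_one := tendsto_value_mul (tendsto_value_simpleLoop α l) (tendsto_value_simpleLoop α k)

theorem IsG2VecPair.pairElt_line {l k : Fin 7 → ℂ} (α : ℂ) (h : IsG2VecPair l k) :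
    pairElt α (line l) (line k) = simpleLoop α l * simpleLoop α k := by
  rw [pairElt, simpleElt_line α h.left_ne_zero h.left_null,
    simpleElt_line α h.right_ne_zero h.right_null, simpleLoop, simpleLoop]

theorem IsG2VecPair.isG2Pair_line {l k : Fin 7 → ℂ} (h : IsG2VecPair l k) :
    IsG2Pair (line l) (line k) :=
  (isG2Pair_line_iff h.left_ne_zero h.right_ne_zero h.left_null h.right_null).mpr h

end PairLoop

/-! ### Dressing a loop twice -/

/-- A vector spanning the line `h(α)⁻¹ L` when `l` spans `L` and `h(α)` is orthogonal. -/
noncomputable def pullVec (α : ℂ) (h : RatMat) (l : Fin 7 → ℂ) : Fin 7 → ℂ :=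
  (value h α)ᵀ *ᵥ l

/-- The dressed loop `p_{α,K} * h` in terms of a vector `k` spanning `K`. -/
noncomputable def dressVec (α : ℂ) (k : Fin 7 → ℂ) (h : RatMat) : RatMat :=
  simpleLoop α k * h * (simpleLoop α (pullVec α h k))ᵀ

section Dress

variable {α : ℂ} {h : RatMat} {l k : Fin 7 → ℂ}

theorem value_mulVec_pullVec (ho : h ∈ orthogonalGroup (Fin 7) (RatFunc ℂ))
    (hr : RegularAt h α) (l : Fin 7 → ℂ) : value h α *ᵥ pullVec α h l = l := by
  rw [pullVec, mulVec_mulVec, (mem_orthogonalGroup_iff _ _).mp (value_mem_orthogonalGroup ho hr),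
    one_mulVec]

theorem pullVec_ne_zero (ho : h ∈ orthogonalGroup (Fin 7) (RatFunc ℂ)) (hr : RegularAt h α)
    (hl : l ≠ 0) : pullVec α h l ≠ 0 := fun h0 => hl <| by
  rw [← value_mulVec_pullVec ho hr l, h0, mulVec_zero]

theorem pullVec_dotProduct_self (ho : h ∈ orthogonalGroup (Fin 7) (RatFunc ℂ))
    (hr : RegularAt h α) (l : Fin 7 → ℂ) : pullVec α h l ⬝ᵥ pullVec α h l = l ⬝ᵥ l := by
  rw [← dotProduct_mulVec_mulVec_of_mem_orthogonalGroup (value_mem_orthogonalGroup ho hr),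
    value_mulVec_pullVec ho hr]

theorem pullLine_line (ho : h ∈ orthogonalGroup (Fin 7) (RatFunc ℂ)) (hr : RegularAt h α)
    (l : Fin 7 → ℂ) : pullLine α h (line l) = line (pullVec α h l) := by
  rw [pullLine, map_line, act_eq, pullVec,
    inv_eq_transpose_of_mem_orthogonalGroup (value_mem_orthogonalGroup ho hr)]

theorem dressVec_mem_orthogonalGroup (ho : h ∈ orthogonalGroup (Fin 7) (RatFunc ℂ))
    (hr : RegularAt h α) (hk : k ≠ 0) (k0 : k ⬝ᵥ k = 0) :
    dressVec α k h ∈ orthogonalGroup (Fin 7) (RatFunc ℂ) := by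
  have := simpleLoop_mem_orthogonalGroup α (pullVec_ne_zero ho hr hk)
    ((pullVec_dotProduct_self ho hr k).trans k0)
  exact mul_mem (mul_mem (simpleLoop_mem_orthogonalGroup α hk k0) ho)
    (transpose_mem_orthogonalGroup this)

theorem regularAt_dressVec (hα : α.im ≠ 0) (ho : h ∈ orthogonalGroup (Fin 7) (RatFunc ℂ))
    (hr : RegularAt h α) (hk : k ≠ 0) (k0 : k ⬝ᵥ k = 0) : RegularAt (dressVec α k h) α :=
  regularAt_simpleLoop_mul_mul_transpose hα ho hr hk k0
    ((pullVec_dotProduct_self ho hr k).trans k0) (value_mulVec_pullVec ho hr k)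

theorem tendsto_value_dressVec (k : Fin 7 → ℂ)
    (ht : Tendsto (value h) (Bornology.cobounded ℂ) (nhds 1)) :
    Tendsto (value (dressVec α k h)) (Bornology.cobounded ℂ) (nhds 1) :=
  tendsto_value_mul (tendsto_value_mul (tendsto_value_simpleLoop α k) ht)
    (tendsto_value_transpose (tendsto_value_simpleLoop α _))

theorem holomorphicAt_dressVec (hα : α.im ≠ 0) (ho : h ∈ orthogonalGroup (Fin 7) (RatFunc ℂ))
    (ht : Tendsto (value h) (Bornology.cobounded ℂ) (nhds 1)) (hr : RegularAt h α) (hk : k ≠ 0)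
    (k0 : k ⬝ᵥ k = 0) : HolomorphicAt SO7 (dressVec α k h) α := by
  have orth := dressVec_mem_orthogonalGroup ho hr hk k0
  have reg := regularAt_dressVec hα ho hr hk k0
  exact ⟨reg, value_mem_SO7 orth (det_eq_one_of_tendsto orth (tendsto_value_dressVec k ht)) reg⟩

theorem dress_line (ho : h ∈ orthogonalGroup (Fin 7) (RatFunc ℂ)) (hr : RegularAt h α)
    (hk : k ≠ 0) (k0 : k ⬝ᵥ k = 0) : dress α (line k) h = dressVec α k h := by
  have hk' := pullVec_ne_zero ho hr hk
  have k0' := (pullVec_dotProduct_self ho hr k).trans k0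
  rw [dress, pullLine_line ho hr, simpleElt_line α hk k0, simpleElt_line α hk' k0', ← simpleLoop,
    ← simpleLoop, dressVec,
    inv_eq_transpose_of_mem_orthogonalGroup (simpleLoop_mem_orthogonalGroup α hk' k0')]

theorem dressVec_dressVec (α : ℂ) (l k : Fin 7 → ℂ) (h : RatMat) :
    dressVec α l (dressVec α k h) = simpleLoop α l * simpleLoop α k * h *
      (simpleLoop α (pullVec α (dressVec α k h) l) * simpleLoop α (pullVec α h k))ᵀ := by
  generalize hg : pullVec α (dressVec α k h) l = l'
  rw [dressVec, hg, dressVec, transpose_mul]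
  simp only [Matrix.mul_assoc]

theorem IsG2VecPair.pullVec (hα : α.im ≠ 0) (hp : IsG2VecPair l k) (hh : IsOctAut h)
    (hr : RegularAt h α) :
    IsG2VecPair (pullVec α (dressVec α k h) l) (pullVec α h k) := by
  have hl := hp.left_ne_zero
  have hk := hp.right_ne_zero
  have l0 := hp.left_null
  have k0 := hp.right_null
  have ho := hh.mem_orthogonalGroup
  have go := dressVec_mem_orthogonalGroup ho hr hk k0
  have gr := regularAt_dressVec hα ho hr hk k0
  have fo := dressVec_mem_orthogonalGroup go gr hl l0
  have fr := regularAt_dressVec hα go gr hl l0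
  have hl' := pullVec_ne_zero go gr hl
  have hk' := pullVec_ne_zero ho hr hk
  have l0' := (pullVec_dotProduct_self go gr l).trans l0
  have k0' := (pullVec_dotProduct_self ho hr k).trans k0
  have mul_eq : dressVec α l (dressVec α k h) *
      (simpleLoop α (G2Loop.pullVec α (dressVec α k h) l) * simpleLoop α (G2Loop.pullVec α h k)) =
      simpleLoop α l * simpleLoop α k * h := by
    rw [dressVec_dressVec, Matrix.mul_assoc, (mem_orthogonalGroup_iff' _ _).mp
      (mul_mem (simpleLoop_mem_orthogonalGroup α hl' l0')
        (simpleLoop_mem_orthogonalGroup α hk' k0')), Matrix.mul_one]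
  obtain ⟨perp, residue_eq⟩ := pairResidue_eq_of_mul_eq hα hl hk hl' hk' hp.perp fo fr hr mul_eq
  exact hp.of_pairResidue_eq (value_mem_orthogonalGroup fo fr) (hh.value hr) hl' l0'
    (value_mulVec_pullVec ho hr k) perp residue_eq

end Dress

end G2Loop

theorem mainTheorem9 (α : ℂ) (hα : α.im ≠ 0)
    (L K : Submodule ℂ C7) (hLK : IsG2Pair L K)
    (h : RatMat) (hloop : IsNegRealLoop G2 h) (hhol : HolomorphicAt G2 h α)
    (K' L' : Submodule ℂ C7) (hK' : K' = pullLine α h K)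
    (hL' : L' = pullLine α (dress α K h) L) :
    HolomorphicAt SO7 (dress α K h) α ∧
    IsG2Pair L' K' ∧
    IsNegRealLoop G2 (pairElt α L' K') ∧
    HasSimplePoleAt (pairElt α L' K') α ∧
    HasSimplePoleAt (pairElt α L' K') (starRingEnd ℂ α) ∧
    IsNegRealLoop G2 (pairElt α L K * h * (pairElt α L' K')⁻¹) ∧
    HolomorphicAt G2 (pairElt α L K * h * (pairElt α L' K')⁻¹) α ∧
    HolomorphicAt G2 (pairElt α L K * h * (pairElt α L' K')⁻¹) (starRingEnd ℂ α) := by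
  obtain ⟨l, hl, l0, rfl⟩ := hLK.left_line.exists_eq_line
  obtain ⟨k, hk, k0, rfl⟩ := hLK.right_line.exists_eq_line
  have hp := (isG2Pair_line_iff hl hk l0 k0).mp hLK
  have hh := hloop.isNegRealOctLoop
  have ho := hh.isOctAut.mem_orthogonalGroup
  have hr := hhol.1
  have go := dressVec_mem_orthogonalGroup ho hr hk k0
  have gr := regularAt_dressVec hα ho hr hk k0
  rw [dress_line ho hr hk k0, pullLine_line go gr] at hL'
  rw [pullLine_line ho hr] at hK'
  subst hL' hK'
  have hp' := hp.pullVec hα hh.isOctAut hr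
  have pair' := hp'.isNegRealOctLoop α
  have pole := hp'.hasSimplePoleAt hα
  have dressed := ((hp.isNegRealOctLoop α).mul hh).mul pair'.transpose
  have reg := regularAt_dressVec hα go gr hl l0
  rw [dressVec_dressVec] at reg
  rw [dress_line ho hr hk k0, hp.pairElt_line, hp'.pairElt_line,
    inv_eq_transpose_of_mem_orthogonalGroup pair'.isOctAut.mem_orthogonalGroup]
  exact ⟨holomorphicAt_dressVec hα ho hh.tendsto_one hr hk k0, hp'.isG2Pair_line,
    pair'.isNegRealLoop, pole, pole.conj pair'.map_ratConj, dressed.isNegRealLoop,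
    dressed.holomorphicAt reg,
    dressed.holomorphicAt ((regularAt_conj_iff dressed.map_ratConj).mpr reg)⟩
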